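/- Let $n\ge 1$, $s\in(0,1)$, $T>0$, and let $\Omega\subset\mathbb R^n$ be a nonempty bounded open set. Let $\mathbb H^s_0(\Omega)$ be the space of (classes of) measurable functions $u:\mathbb R^n\to\mathbb R$ with $u|_\Omega\in L^2(\Omega)$, $u=0$ a.e. in $\mathbb R^n\setminus\Omega$, and $(x,y)\mapsto (u(x)-u(y))|x-y|^{-(n+2s)/2}$ in $L^2\big((\mathbb R^n\times\mathbb R^n)\setminus((\mathbb R^n\setminus\Omega)\times(\mathbb R^n\setminus\Omega))\big)$, equipped with the scalar product $$\langle u,v\rangle_{\mathbb H^s_0}=\int_{\mathbb R^n\times\mathbb R^n}\frac{(u(x)-u(y))(v(x)-v(y))}{|x-y|^{n+2s}}\,dx\,dy$$ and the corresponding norm. Elements of $L^2(\Omega)$ are extended by zero to $\mathbb R^n$. A real number $\lambda$ is an eigenvalue, with eigenfunction $w\in\mathbb H^s_0(\Omega)\setminus\{0\}$, if $\langle w,v\rangle_{\mathbb H^s_0}=\lambda\,(w,v)_{L^2(\Omega)}$ for all $v\in\mathbb H^s_0(\Omega)$. Let $\varphi\in L^2(\Omega)$, $f\in C([0,T];L^2(\Omega))\cap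 C^1((0,T];L^2(\Omega))$ and $p\in C[0,T]$. A weak solution of the Cauchy–Dirichlet problem $$\partial_t u+(-\Delta)^s u=p(t)u+f\ \text{ in }\Omega\times(0,T),\qquad u(\cdot,0)=\varphi\ \text{ in }\Omega,\qquad u=0\ \text{ in }(\mathbb R^n\setminus\Omega)\times(0,T)$$ is a function $u\in C([0,T];L^2(\Omega))\cap C((0,T];\mathbb H^s_0(\Omega))\cap C^1((0,T];L^2(\Omega))$ such that $u(0)=\varphi$ and, for all $t\in(0,T)$ and all $v\in\mathbb H^s_0(\Omega)$, $$(\partial_t u(t),v)_{L^2(\Omega)}+\langle u(t),v\rangle_{\mathbb H^s_0}=(p(t)u(t),v)_{L^2(\Omega)}+(f(t),v)_{L^2(\Omega)}.$$ Then the eigenvalues can be listed as a sequence $\lambda_1\le\lambda_2\le\dots$, each repeated according to its multiplicity, with corresponding eigenfunctions $\phi_1,\phi_2,\dots$ orthonormal in $L^2(\Omega)$. For every such listing, put $\varphi_k=(\varphi,\phi_k)_{L^2(\Omega)}$ and $f_k(t)=(f(t),\phi_k)_{L^2(\Omega)}$. Then both series in $$u(\cdot,t)=\sum_{k=1}^{\infty}\varphi_k\,e^{-\lambda_k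 t+\int_0^t p(\tau)\,d\tau}\,\phi_k+\sum_{k=1}^{\infty}\Big(\int_0^t f_k(\tau)\,e^{-\lambda_k(t-\tau)+\int_\tau^t p(y)\,dy}\,d\tau\Big)\phi_k$$ converge in $L^2(\Omega)$ for every $t\in[0,T]$, and the function $u$ so defined is the unique weak solution of the problem; that is, it is a weak solution, and every weak solution coincides with it on $[0,T]$. -/

import Mathlib

open MeasureTheory Set Filter Topology

noncomputable section

namespace FracHeat

/-- The Euclidean space `ℝⁿ`. -/
abbrev Space (n : ℕ) : Type := EuclideanSpace ℝ (Fin n)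

/-- The real Hilbert space `L²(Ω)`. -/
abbrev L2 {n : ℕ} (Ω : Set (Space n)) : Type := Lp ℝ 2 (volume.restrict Ω)

/-- The extension by zero to `ℝⁿ` of an element of `L²(Ω)`. -/
def zeroExt {n : ℕ} (Ω : Set (Space n)) (u : L2 Ω) : Space n → ℝ :=
  Ω.indicator u

/-- The set `Q = (ℝⁿ × ℝⁿ) \ (Ωᶜ × Ωᶜ)`. -/
def crossSet {n : ℕ} (Ω : Set (Space n)) : Set (Space n × Space n) :=
  (Ωᶜ ×ˢ Ωᶜ)ᶜ

/-- The space `ℍˢ(Ω)`: measurable functions on `ℝⁿ` whose restriction to `Ω` is in `L²(Ω)` and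
such that `(x, y) ↦ (u x - u y) / |x - y| ^ ((n + 2 s) / 2)` is in `L²(Q)`. -/
structure MemHs {n : ℕ} (s : ℝ) (Ω : Set (Space n)) (u : Space n → ℝ) : Prop where
  aemeasurable : AEMeasurable u volume
  memLp : MemLp u 2 (volume.restrict Ω)
  memLp_quotient :
    MemLp (fun z : Space n × Space n =>
      (u z.1 - u z.2) / ‖z.1 - z.2‖ ^ (((n : ℝ) + 2 * s) / 2)) 2
      (volume.restrict (crossSet Ω))

/-- The space `ℍ₀ˢ(Ω)`: elements of `ℍˢ(Ω)` that vanish a.e. outside `Ω`. -/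
structure MemH0s {n : ℕ} (s : ℝ) (Ω : Set (Space n)) (u : Space n → ℝ) : Prop where
  memHs : MemHs s Ω u
  ae_eq_zero : ∀ᵐ x ∂(volume.restrict Ωᶜ), u x = 0

/-- The scalar product of `ℍ₀ˢ(Ω)`:
`∫∫ (u x - u y) (v x - v y) / |x - y| ^ (n + 2 s) dx dy` over `ℝⁿ × ℝⁿ`. -/
def innerH0s {n : ℕ} (s : ℝ) (u v : Space n → ℝ) : ℝ :=
  ∫ z : Space n × Space n,
    (u z.1 - u z.2) * (v z.1 - v z.2) / ‖z.1 - z.2‖ ^ ((n : ℝ) + 2 * s)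

/-- The norm of `ℍ₀ˢ(Ω)`. -/
def normH0s {n : ℕ} (s : ℝ) (u : Space n → ℝ) : ℝ :=
  Real.sqrt (innerH0s s u u)

/-- `w` is an eigenfunction for the eigenvalue `μ` of the weak formulation of the Dirichlet problem
`(-Δ)ˢ w = μ w` in `Ω`, `w = 0` outside `Ω`. -/
structure IsEigenpair {n : ℕ} (s : ℝ) (Ω : Set (Space n)) (μ : ℝ) (w : L2 Ω) : Prop where
  ne_zero : w ≠ 0
  memH0s : MemH0s s Ω (zeroExt Ω w)
  weak_eq : ∀ v : Space n → ℝ, MemH0s s Ω v →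
    innerH0s s (zeroExt Ω w) v = μ * ∫ x in Ω, w x * v x

/-- `lam 0 ≤ lam 1 ≤ …` lists all the eigenvalues, each repeated according to its multiplicity, and
`e 0, e 1, …` are corresponding eigenfunctions, orthonormal in `L²(Ω)`. (Completeness of `e`
in `L²(Ω)` is not part of the definition.) -/
structure IsEigensystem {n : ℕ} (s : ℝ) (Ω : Set (Space n)) (lam : ℕ → ℝ) (e : ℕ → L2 Ω) :
    Prop where
  eigenpair : ∀ k, IsEigenpair s Ω (lam k) (e k)
  orthonormal : Orthonormal ℝ e
  monotone : Monotone lam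
  exhausts : ∀ (μ : ℝ) (w : L2 Ω), IsEigenpair s Ω μ w →
    w ∈ Submodule.span ℝ (e '' {k | lam k = μ})

/-- `u ∈ C((0,T]; ℍ₀ˢ(Ω))`. -/
structure ContinuousInH0s {n : ℕ} (s : ℝ) (Ω : Set (Space n)) (T : ℝ) (u : ℝ → L2 Ω) :
    Prop where
  memH0s : ∀ t ∈ Ioc (0 : ℝ) T, MemH0s s Ω (zeroExt Ω (u t))
  tendsto : ∀ t ∈ Ioc (0 : ℝ) T,
    Tendsto (fun τ => normH0s s (zeroExt Ω (u τ) - zeroExt Ω (u t))) (𝓝[Ioc 0 T] t) (𝓝 0)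

/-- `u ∈ C([0,T]; L²(Ω)) ∩ C((0,T]; ℍ₀ˢ(Ω)) ∩ C¹((0,T]; L²(Ω))` is a weak solution of
`∂ₜu + (-Δ)ˢ u = p u + f` in `Ω × (0,T)`, `u(0) = φ` in `Ω`, `u = 0` outside `Ω`. -/
structure IsWeakSolution {n : ℕ} (s : ℝ) (Ω : Set (Space n)) (T : ℝ) (p : ℝ → ℝ)
    (f : ℝ → L2 Ω) (φ : L2 Ω) (u : ℝ → L2 Ω) : Prop where
  continuousOn : ContinuousOn u (Icc 0 T)
  continuousInH0s : ContinuousInH0s s Ω T u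
  contDiffOn : ContDiffOn ℝ 1 u (Ioc 0 T)
  weak_eq : ∀ t ∈ Ioo (0 : ℝ) T, ∀ v : Space n → ℝ, MemH0s s Ω v →
    (∫ x in Ω, (deriv u t) x * v x) + innerH0s s (zeroExt Ω (u t)) v
      = (∫ x in Ω, p t * (u t) x * v x) + ∫ x in Ω, (f t) x * v x
  initial : u 0 = φ

/-- The coefficient `φₖ exp (-λₖ t + ∫₀ᵗ p)`, where `φₖ = (φ, eₖ)`. -/
def homCoeff {n : ℕ} {Ω : Set (Space n)} (lam : ℕ → ℝ) (e : ℕ → L2 Ω) (p : ℝ → ℝ) (φ : L2 Ω)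
    (k : ℕ) (t : ℝ) : ℝ :=
  inner ℝ φ (e k) * Real.exp (-lam k * t + ∫ τ in (0 : ℝ)..t, p τ)

/-- The coefficient `∫₀ᵗ fₖ(τ) exp (-λₖ (t - τ) + ∫_τ^t p) dτ`, where `fₖ(τ) = (f(τ), eₖ)`. -/
def sourceCoeff {n : ℕ} {Ω : Set (Space n)} (lam : ℕ → ℝ) (e : ℕ → L2 Ω) (p : ℝ → ℝ)
    (f : ℝ → L2 Ω) (k : ℕ) (t : ℝ) : ℝ :=
  ∫ τ in (0 : ℝ)..t, inner ℝ (f τ) (e k) * Real.exp (-lam k * (t - τ) + ∫ y in τ..t, p y)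

/-- The eigenfunction series of the solution. -/
def seriesSolution {n : ℕ} {Ω : Set (Space n)} (lam : ℕ → ℝ) (e : ℕ → L2 Ω) (p : ℝ → ℝ)
    (f : ℝ → L2 Ω) (φ : L2 Ω) (t : ℝ) : L2 Ω :=
  (∑' k, homCoeff lam e p φ k t • e k) + ∑' k, sourceCoeff lam e p f k t • e k

end FracHeat

end

/-!
The weak solution is unique because testing the equation with an eigenfunction turns it into a
scalar linear differential equation for each Fourier coefficient, so that the coefficients are
those of the series.

The eigenfunctions form a Hilbert basis since `(1 + (-Δ)ˢ)⁻¹ = J J*`, where `J` is the embedding of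
the form domain `ℍ₀ˢ(Ω)` into `L²(Ω)`. It is injective because smooth functions with compact support
in `Ω` are dense, and it is compact because averaging over the cells of a fine grid is an operator
of finite rank whose error is controlled by the difference quotients.

For the existence, the substitution `u = exp (∫ p) • V` removes the potential, leaving Duhamel's
formula for `V' + A V = g`. As `g` is only `C¹`, the derivative is found from the coefficients of
`g - A V`, which solve the same kind of equation with source `g'` on every `[c, T]` with `0 < c`.
The equation then expresses `A u` as a continuous function of time, which gives both the membership
in `ℍ₀ˢ(Ω)` and the continuity there, since `‖u‖²_{ℍ₀ˢ} = (A u, u)`.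
-/

noncomputable section

namespace FracHeat

section CompactOperator

open scoped InnerProductSpace
open Module.End

theorem exists_equiv_nat_monotone {J α : Type*} [Infinite J] [LinearOrder α] {f : J → α}
    (hf : ∀ c, {j | f j ≤ c}.Finite) : ∃ σ : ℕ ≃ J, Monotone (f ∘ σ) := by
  classical
  -- Ties between equal values of `f` are broken by an arbitrary linear order on `J`.
  let _ : LinearOrder J := linearOrderOfSTO WellOrderingRel
  let key : J → α ×ₗ J := fun j => toLex (f j, j)
  have hkey : Monotone fun x : α ×ₗ J => (ofLex x).1 := Prod.Lex.monotone_fst_ofLex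
  have hfin (j : J) : {i | key i < key j}.Finite :=
    (hf (f j)).subset fun i hi => hkey (le_of_lt hi)
  let rank : J → ℕ := fun j => {i | key i < key j}.ncard
  have rank_lt {i j : J} (hij : key i < key j) : rank i < rank j :=
    Set.ncard_lt_ncard ⟨fun l hl => lt_trans hl hij, fun h => lt_irrefl (key i) (h hij)⟩ (hfin j)
  have le_of_rank_le {i j : J} (hij : rank i ≤ rank j) : key i ≤ key j :=
    not_lt.1 fun h => (rank_lt h).not_ge hij
  have rank_injective : Function.Injective rank := fun i j hij =>
    congrArg (fun x => (ofLex x).2) ((le_of_rank_le hij.le).antisymm (le_of_rank_le hij.ge))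
  have : Infinite (range rank) :=
    Set.infinite_coe_iff.2 (Set.infinite_range_of_injective rank_injective)
  let ofRank := Equiv.ofInjective rank rank_injective
  refine ⟨(Nat.Subtype.orderIsoOfNat (range rank)).toEquiv.trans ofRank.symm, fun m k hmk => ?_⟩
  refine hkey (le_of_rank_le ?_)
  have hrank (x : range rank) : rank (ofRank.symm x) = x :=
    congrArg Subtype.val (ofRank.apply_symm_apply x)
  simp only [Equiv.trans_apply, hrank]
  exact (Nat.Subtype.orderIsoOfNat (range rank)).monotone hmk

variable {ι H : Type*} [NormedAddCommGroup H] [InnerProductSpace ℝ H] {T : H →L[ℝ] H}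

theorem le_norm_smul_sub_smul {x y : H} (hx : ‖x‖ = 1) (hxy : ⟪x, y⟫_ℝ = 0) (a b : ℝ) :
    |a| ≤ ‖a • x - b • y‖ := by
  have h : ⟪x, a • x - b • y⟫_ℝ = a := by
    rw [inner_sub_right, inner_smul_right, inner_smul_right, hxy, real_inner_self_eq_norm_sq, hx]
    ring
  simpa [h, hx] using abs_real_inner_le_norm x (a • x - b • y)

theorem tendsto_eigenvalue_cofinite (hc : IsCompactOperator T) {e : ι → H} (he : Orthonormal ℝ e)
    {κ : ι → ℝ} (hT : ∀ i, T (e i) = κ i • e i) : Tendsto κ cofinite (𝓝 0) := by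
  rw [tendsto_zero_iff_abs_tendsto_zero, tendsto_order]
  refine ⟨fun c hc0 => .of_forall fun i => hc0.trans_le (abs_nonneg _), fun ε hε => ?_⟩
  by_contra hinf
  have : Infinite {i | ¬ |κ i| < ε} := Set.infinite_coe_iff.2 hinf
  obtain ⟨g⟩ : Nonempty (ℕ ↪ {i | ¬ |κ i| < ε}) := ⟨Infinite.natEmbedding _⟩
  have hmem (k : ℕ) : T (e (g k)) ∈ closure (T '' Metric.closedBall 0 1) :=
    subset_closure ⟨e (g k), by simp [he.1], rfl⟩
  obtain ⟨a, -, ψ, hψ, hlim⟩ :=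
    (hc.isCompact_closure_image_closedBall (f := T.toLinearMap) 1).tendsto_subseq hmem
  obtain ⟨N, hN⟩ := Metric.cauchySeq_iff'.1 hlim.cauchySeq ε hε
  have hlt := hN (N + 1) N.le_succ
  have hne : (g (ψ (N + 1)) : ι) ≠ g (ψ N) :=
    fun h => (hψ N.lt_succ_self).ne' (g.injective (Subtype.ext h))
  simp only [Function.comp_apply, hT, dist_eq_norm] at hlt
  exact (g (ψ (N + 1))).2
    ((le_norm_smul_sub_smul (he.1 _) (he.2 hne) _ _).trans_lt hlt)

theorem eigenvalue_pos (hT : T.IsPositive) (hinj : Function.Injective T) {c : ℝ} {w : H}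
    (hw : w ≠ 0) (hTw : T w = c • w) : 0 < c := by
  have hnonneg : 0 ≤ c * ‖w‖ ^ 2 := by
    simpa [hTw, inner_smul_left, real_inner_self_eq_norm_sq] using hT.inner_nonneg_left w
  refine (nonneg_of_mul_nonneg_left hnonneg (by positivity)).lt_of_ne' fun hc0 => hw (hinj ?_)
  rw [hTw, hc0, zero_smul, map_zero]

theorem mem_span_of_apply_eq_smul (hs : T.IsSymmetric) (b : HilbertBasis ι ℝ H) {κ : ι → ℝ}
    (hT : ∀ i, T (b i) = κ i • b i) {c : ℝ} (hfin : {i | κ i = c}.Finite) {w : H}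
    (hw : T w = c • w) : w ∈ Submodule.span ℝ (b '' {i | κ i = c}) := by
  have hcoeff (i : ι) (hi : κ i ≠ c) : ⟪b i, w⟫_ℝ = 0 := by
    have h : ⟪T (b i), w⟫_ℝ = ⟪b i, T w⟫_ℝ := hs (b i) w
    rw [hT, hw, real_inner_smul_left, real_inner_smul_right] at h
    exact (mul_eq_mul_right_iff.1 h).resolve_left hi
  have hsum : HasSum (fun i => ⟪b i, w⟫_ℝ • b i) (∑ i ∈ hfin.toFinset, ⟪b i, w⟫_ℝ • b i) :=
    hasSum_sum_of_ne_finset_zero fun i hi => by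
      rw [hcoeff i fun h => hi (hfin.mem_toFinset.2 h), zero_smul]
  have hrepr : HasSum (fun i => ⟪b i, w⟫_ℝ • b i) w := by
    simpa only [b.repr_apply_apply] using b.hasSum_repr w
  rw [hrepr.unique hsum]
  exact Submodule.sum_mem _ fun i hi =>
    Submodule.smul_mem _ _ (Submodule.subset_span ⟨i, hfin.mem_toFinset.1 hi, rfl⟩)

variable [CompleteSpace H]

theorem orthogonal_span_eq_bot_of_forall_eigenvector_mem (hc : IsCompactOperator T)
    (hs : T.IsSymmetric) (hinj : Function.Injective T) {A : Set H}
    (hA : ∀ (c : ℝ) (w : H), c ≠ 0 → w ≠ 0 → T w = c • w → w ∈ Submodule.span ℝ A) :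
    (Submodule.span ℝ A)ᗮ = ⊥ := by
  rw [eq_bot_iff, ← T.orthogonalComplement_iSup_eigenspaces_eq_bot hc hs]
  refine Submodule.orthogonal_le (iSup_le fun c w hw => ?_)
  have hTw : T w = c • w := mem_eigenspace_iff.1 hw
  by_cases hw0 : w = 0
  · exact hw0 ▸ zero_mem _
  refine hA c w (fun hc0 => hw0 (hinj ?_)) hw0 hTw
  rw [hTw, hc0, zero_smul, map_zero]

theorem exists_orthonormal_eigenvectors (hc : IsCompactOperator T) (hs : T.IsSymmetric)
    (hinj : Function.Injective T) :
    ∃ (J : Type) (κ : J → ℝ) (e : J → H), Orthonormal ℝ e ∧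
      (∀ j, T (e j) = κ j • e j) ∧ (Submodule.span ℝ (range e))ᗮ = ⊥ := by
  let E : {c : ℝ // c ≠ 0} → Submodule ℝ H := fun c => eigenspace T.toLinearMap c
  have hE (c : {c : ℝ // c ≠ 0}) : FiniteDimensional ℝ (E c) :=
    T.finite_dimensional_eigenspace hc c c.2
  let B := fun c => stdOrthonormalBasis ℝ (E c)
  refine ⟨Σ c : {c : ℝ // c ≠ 0}, Fin (Module.finrank ℝ (E c)), fun j => j.1,
    fun j => (B j.1 j.2 : H),
    (hs.orthogonalFamily_eigenspaces.comp Subtype.val_injective).orthonormal_sigma_orthonormal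
      fun c => (B c).orthonormal,
    fun j => mem_eigenspace_iff.1 (B j.1 j.2).2,
    orthogonal_span_eq_bot_of_forall_eigenvector_mem hc hs hinj fun c w hc0 _ hw => ?_⟩
  let w' : E ⟨c, hc0⟩ := ⟨w, mem_eigenspace_iff.2 hw⟩
  have hw' : w = ∑ i, (B ⟨c, hc0⟩).repr w' i • (B ⟨c, hc0⟩ i : H) := by
    simpa using (congrArg Subtype.val ((B ⟨c, hc0⟩).sum_repr w')).symm
  rw [hw']
  exact Submodule.sum_mem _ fun i _ =>
    Submodule.smul_mem _ _ (Submodule.subset_span ⟨⟨⟨c, hc0⟩, i⟩, rfl⟩)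

theorem exists_hilbertBasis_eigenvectors (hc : IsCompactOperator T) (hpos : T.IsPositive)
    (hinj : Function.Injective T) (hinf : ¬ FiniteDimensional ℝ H) :
    ∃ (μ : ℕ → ℝ) (b : HilbertBasis ℕ ℝ H), Monotone μ ∧ (∀ k, 0 < μ k) ∧
      ∀ k, T (b k) = (μ k)⁻¹ • b k := by
  obtain ⟨J, κ, e, he, hTe, hspan⟩ := exists_orthonormal_eigenvectors hc hpos.isSymmetric hinj
  have hκ (j : J) : 0 < κ j := eigenvalue_pos hpos hinj (he.ne_zero j) (hTe j)
  have : Infinite J := by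
    by_contra hJ
    have := not_infinite_iff_finite.1 hJ
    have := Fintype.ofFinite J
    exact hinf (Module.Finite.of_basis
      (HilbertBasis.mkOfOrthogonalEqBot he hspan).toOrthonormalBasis.toBasis)
  have hfin (c : ℝ) : {j | (κ j)⁻¹ ≤ c}.Finite := by
    rcases le_or_gt c 0 with hc0 | hc0
    · exact Set.finite_empty.subset fun j hj => ((inv_pos.2 (hκ j)).trans_le hj).not_ge hc0
    · refine ((tendsto_eigenvalue_cofinite hc he hTe).eventually_lt_const
        (inv_pos.2 hc0)).subset fun j hj => ?_
      exact not_lt.2 (inv_le_of_inv_le₀ (hκ j) hj)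
  obtain ⟨σ, hσ⟩ := exists_equiv_nat_monotone hfin
  have heσ : (Submodule.span ℝ (range (e ∘ σ)))ᗮ = ⊥ := by rwa [σ.surjective.range_comp]
  refine ⟨fun k => (κ (σ k))⁻¹, HilbertBasis.mkOfOrthogonalEqBot (he.comp σ σ.injective) heσ, hσ,
    fun k => inv_pos.2 (hκ _), fun k => ?_⟩
  simp only [HilbertBasis.coe_mkOfOrthogonalEqBot, Function.comp_apply, hTe, inv_inv]

end CompactOperator

section HilbertBasis

open scoped InnerProductSpace

variable {ι H : Type*} [NormedAddCommGroup H] [InnerProductSpace ℝ H] (b : HilbertBasis ι ℝ H)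

theorem ext_inner {x y : H} (h : ∀ k, ⟪b k, x⟫_ℝ = ⟪b k, y⟫_ℝ) : x = y := by
  apply b.repr.injective
  ext k
  rw [b.repr_apply_apply, b.repr_apply_apply, h]

theorem hasSum_inner_smul (x : H) : HasSum (fun k => ⟪b k, x⟫_ℝ • b k) x := by
  simpa only [b.repr_apply_apply] using b.hasSum_repr x

theorem hasSum_inner_sq (x : H) : HasSum (fun k => ⟪b k, x⟫_ℝ ^ 2) (‖x‖ ^ 2) := by
  simpa only [real_inner_comm x, ← sq, real_inner_self_eq_norm_sq] using
    b.hasSum_inner_mul_inner x x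

/-- The vector whose coefficients in the Hilbert basis `b` are `c`; it is meaningful only for square
summable `c`. -/
def ofCoeff (c : ι → ℝ) : H := ∑' k, c k • b k

theorem inner_ofCoeff {c : ι → ℝ} (hc : Memℓp c 2) (k : ι) : ⟪b k, ofCoeff b c⟫_ℝ = c k := by
  have h : ofCoeff b c = b.repr.symm ⟨c, hc⟩ := (b.hasSum_repr_symm ⟨c, hc⟩).tsum_eq
  rw [h, ← b.repr_apply_apply, LinearIsometryEquiv.apply_symm_apply]

theorem ofCoeff_inner (x : H) : ofCoeff b (fun k => ⟪b k, x⟫_ℝ) = x :=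
  (hasSum_inner_smul b x).tsum_eq

/-- The operator multiplying the coefficient of `b k` by `m k`; its domain consists of the `x` for
which the products `m k * ⟪b k, x⟫` are square summable. -/
def multiplier (m : ι → ℝ) (x : H) : H := ofCoeff b fun k => m k * ⟪b k, x⟫_ℝ

variable {m : ι → ℝ} {C : ℝ}

theorem mul_inner_sq_le (hm : ∀ k, |m k| ≤ C) (x : H) (k : ι) :
    (m k * ⟪b k, x⟫_ℝ) ^ 2 ≤ C ^ 2 * ⟪b k, x⟫_ℝ ^ 2 := by
  rw [mul_pow]
  exact mul_le_mul_of_nonneg_right (sq_le_sq' (abs_le.1 (hm k)).1 (abs_le.1 (hm k)).2) (sq_nonneg _)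

theorem inner_multiplier (hm : ∀ k, |m k| ≤ C) (x : H) (k : ι) :
    ⟪b k, multiplier b m x⟫_ℝ = m k * ⟪b k, x⟫_ℝ := by
  refine inner_ofCoeff b (memℓp_gen ?_) k
  refine ((hasSum_inner_sq b x).summable.mul_left (C ^ 2)).of_nonneg_of_le
    (fun k => by positivity) fun k => ?_
  simpa only [ENNReal.toReal_ofNat, Real.rpow_ofNat, Real.norm_eq_abs, sq_abs] using
    mul_inner_sq_le b hm x k

theorem multiplier_sub (hm : ∀ k, |m k| ≤ C) (x y : H) :
    multiplier b m (x - y) = multiplier b m x - multiplier b m y :=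
  ext_inner b fun k => by simp only [inner_sub_right, inner_multiplier b hm, mul_sub]

theorem norm_multiplier_le (hC : 0 ≤ C) (hm : ∀ k, |m k| ≤ C) (x : H) :
    ‖multiplier b m x‖ ≤ C * ‖x‖ := by
  refine le_of_sq_le_sq ?_ (by positivity)
  rw [mul_pow]
  refine hasSum_le (fun k => ?_) (hasSum_inner_sq b (multiplier b m x))
    ((hasSum_inner_sq b x).mul_left (C ^ 2))
  rw [inner_multiplier b hm]
  exact mul_inner_sq_le b hm x k

variable {X : Type*} [TopologicalSpace X] {m : X → ι → ℝ}

theorem continuous_multiplier_apply (hm : ∀ t k, |m t k| ≤ C) (hc : ∀ k, Continuous fun t => m t k)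
    (x : H) : Continuous fun t => multiplier b (m t) x := by
  refine continuous_iff_continuousAt.2 fun t₀ => ?_
  rw [ContinuousAt, tendsto_iff_norm_sub_tendsto_zero]
  suffices Tendsto (fun t => ‖multiplier b (m t) x - multiplier b (m t₀) x‖ ^ 2) (𝓝 t₀) (𝓝 0) by
    simpa using this.sqrt
  have hterm (t : X) (k : ι) : ⟪b k, multiplier b (m t) x - multiplier b (m t₀) x⟫_ℝ ^ 2
      = ((m t k - m t₀ k) * ⟪b k, x⟫_ℝ) ^ 2 := by
    rw [inner_sub_right, inner_multiplier b (hm t), inner_multiplier b (hm t₀), sub_mul]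
  simp_rw [← (hasSum_inner_sq b _).tsum_eq, hterm]
  rw [← tsum_zero (α := ℝ) (β := ι)]
  refine tendsto_tsum_of_dominated_convergence (bound := fun k => (C + C) ^ 2 * ⟪b k, x⟫_ℝ ^ 2)
    ((hasSum_inner_sq b x).summable.mul_left _) (fun k => ?_) (.of_forall fun t k => ?_)
  · simpa using ((((hc k).tendsto t₀).sub_const (m t₀ k)).mul_const ⟪b k, x⟫_ℝ).pow 2
  · rw [Real.norm_of_nonneg (sq_nonneg _)]
    exact mul_inner_sq_le b (fun k => (abs_sub _ _).trans (add_le_add (hm t k) (hm t₀ k))) x k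

theorem continuous_multiplier (hC : 0 ≤ C) (hm : ∀ t k, |m t k| ≤ C)
    (hc : ∀ k, Continuous fun t => m t k) : Continuous fun z : X × H => multiplier b (m z.1) z.2 :=
  continuous_prod_of_continuous_lipschitzWith' _ ⟨C, hC⟩
    (fun t => LipschitzWith.of_dist_le_mul fun x y => by
      rw [dist_eq_norm, dist_eq_norm, ← multiplier_sub b (hm t)]
      exact norm_multiplier_le b hC (hm t) _)
    (continuous_multiplier_apply b hm hc)

end HilbertBasis

section Calculus

theorem exists_continuous_eqOn_Icc {E : Type*} [TopologicalSpace E] {f : ℝ → E} {a b : ℝ}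
    (hab : a ≤ b) (hf : ContinuousOn f (Icc a b)) :
    ∃ F : ℝ → E, Continuous F ∧ EqOn F f (Icc a b) :=
  ⟨IccExtend hab ((Icc a b).domRestrict f),
    (continuousOn_iff_continuous_domRestrict.1 hf).Icc_extend',
    fun x hx => by rw [IccExtend_of_mem hab _ hx]; rfl⟩

theorem exists_continuous_hasDerivAt {E : Type*} [NormedAddCommGroup E] [NormedSpace ℝ E]
    {h : ℝ → E} {a c T : ℝ} (hh : ContDiffOn ℝ 1 h (Ioc a T)) (hc : c ∈ Ioc a T) :
    ∃ h' : ℝ → E, Continuous h' ∧ ∀ t ∈ Ioo c T, HasDerivAt h (h' t) t := by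
  obtain ⟨hdiff, hcont⟩ := (contDiffOn_one_iff_derivWithin (uniqueDiffOn_Ioc a T)).1 hh
  have hsub : Icc c T ⊆ Ioc a T := fun x hx => ⟨hc.1.trans_le hx.1, hx.2⟩
  obtain ⟨h', hh', heq⟩ := exists_continuous_eqOn_Icc hc.2 (hcont.mono hsub)
  refine ⟨h', hh', fun t ht => ?_⟩
  rw [heq (Ioo_subset_Icc_self ht)]
  exact (hdiff t (hsub (Ioo_subset_Icc_self ht))).hasDerivWithinAt.hasDerivAt
    (Ioc_mem_nhds (hc.1.trans ht.1) ht.2)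

theorem hasDerivAt_exp_mul_add_integral {q Q γ : ℝ → ℝ} (hQ : ∀ t, HasDerivAt Q (q t) t)
    (hγ : Continuous γ) (a c t : ℝ) :
    HasDerivAt (fun t => Real.exp (Q t - Q a) * c + ∫ τ in a..t, Real.exp (Q t - Q τ) * γ τ)
      (q t * (Real.exp (Q t - Q a) * c + ∫ τ in a..t, Real.exp (Q t - Q τ) * γ τ) + γ t) t := by
  have hQc : Continuous Q := continuous_iff_continuousAt.2 fun t => (hQ t).continuousAt
  have hsplit (t τ : ℝ) : Real.exp (Q t - Q τ) = Real.exp (Q t) * Real.exp (-Q τ) := by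
    rw [← Real.exp_add, sub_eq_add_neg]
  simp_rw [hsplit, mul_assoc, intervalIntegral.integral_const_mul]
  have hint : HasDerivAt (fun t => ∫ τ in a..t, Real.exp (-Q τ) * γ τ) (Real.exp (-Q t) * γ t) t :=
    (Continuous.integral_hasStrictDerivAt (by fun_prop) a t).hasDerivAt
  refine (((hQ t).exp.mul_const (Real.exp (-Q a) * c)).add ((hQ t).exp.mul hint)).congr_deriv ?_
  have hcancel : Real.exp (Q t) * Real.exp (-Q t) = 1 := by rw [← Real.exp_add]; simp
  linear_combination γ t * hcancel

theorem eq_exp_mul_add_integral {q Q γ d : ℝ → ℝ} {a b : ℝ} (hQ : ContinuousOn Q (Icc a b))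
    (hQ' : ∀ t ∈ Ioo a b, HasDerivAt Q (q t) t) (hγ : ContinuousOn γ (Icc a b))
    (hd : ContinuousOn d (Icc a b)) (hd' : ∀ t ∈ Ioo a b, HasDerivAt d (q t * d t + γ t) t) {t : ℝ}
    (ht : t ∈ Icc a b) :
    d t = Real.exp (Q t - Q a) * d a + ∫ τ in a..t, Real.exp (Q t - Q τ) * γ τ := by
  have hsub : Icc a t ⊆ Icc a b := Icc_subset_Icc_right ht.2
  have hE : ContinuousOn (fun τ => Real.exp (-Q τ)) (Icc a t) := (hQ.mono hsub).neg.rexp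
  have hint : ∫ τ in a..t, Real.exp (-Q τ) * γ τ
      = Real.exp (-Q t) * d t - Real.exp (-Q a) * d a := by
    refine intervalIntegral.integral_eq_sub_of_hasDerivAt_of_le
      (f := fun τ => Real.exp (-Q τ) * d τ) ht.1 (hE.mul (hd.mono hsub)) (fun τ hτ => ?_)
      (ContinuousOn.intervalIntegrable_of_Icc ht.1 (hE.mul (hγ.mono hsub)))
    have hτ' : τ ∈ Ioo a b := ⟨hτ.1, hτ.2.trans_le ht.2⟩
    refine ((hQ' τ hτ').neg.exp.mul (hd' τ hτ')).congr_deriv ?_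
    simp only [Pi.neg_apply]
    ring
  have hsplit (τ : ℝ) : Real.exp (Q t - Q τ) = Real.exp (Q t) * Real.exp (-Q τ) := by
    rw [← Real.exp_add, sub_eq_add_neg]
  have hcancel : Real.exp (Q t) * Real.exp (-Q t) = 1 := by rw [← Real.exp_add]; simp
  simp_rw [hsplit, mul_assoc, intervalIntegral.integral_const_mul, hint]
  linear_combination -d t * hcancel

end Calculus

section DiagonalSemigroup

open scoped InnerProductSpace

variable {ι H : Type*} [NormedAddCommGroup H] [InnerProductSpace ℝ H] (b : HilbertBasis ι ℝ H)
  {lam : ι → ℝ} {φ : H} {h : ℝ → H} {a t : ℝ}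

/-- The semigroup `exp (-t A)` of the diagonal operator `A (b k) = lam k • b k`. It is extended to
negative times by `|t|`, so that it is continuous on the whole line. -/
def semigroup (lam : ι → ℝ) (t : ℝ) (x : H) : H :=
  multiplier b (fun k => Real.exp (-lam k * |t|)) x

theorem abs_exp_neg_mul_abs_le_one {l : ℝ} (hl : 0 ≤ l) (t : ℝ) : |Real.exp (-l * |t|)| ≤ 1 := by
  rw [Real.abs_exp, Real.exp_le_one_iff, neg_mul, neg_nonpos]
  positivity

theorem inner_semigroup (hlam : ∀ k, 0 ≤ lam k) (ht : 0 ≤ t) (x : H) (k : ι) :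
    ⟪b k, semigroup b lam t x⟫_ℝ = Real.exp (-lam k * t) * ⟪b k, x⟫_ℝ := by
  rw [semigroup, inner_multiplier b fun k => abs_exp_neg_mul_abs_le_one (hlam k) t,
    abs_of_nonneg ht]

theorem continuous_semigroup (hlam : ∀ k, 0 ≤ lam k) :
    Continuous fun z : ℝ × H => semigroup b lam z.1 z.2 :=
  continuous_multiplier b zero_le_one (fun t k => abs_exp_neg_mul_abs_le_one (hlam k) t)
    fun k => by fun_prop

/-- The operator `A exp (-t A)` of the diagonal operator `A (b k) = lam k • b k`; it is bounded for
`0 < t`. -/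
def generatorSemigroup (lam : ι → ℝ) (t : ℝ) (x : H) : H :=
  multiplier b (fun k => lam k * Real.exp (-lam k * t)) x

theorem mul_exp_neg_mul_le_inv {l : ℝ} (ht : 0 < t) : l * Real.exp (-l * t) ≤ t⁻¹ := by
  have hexp : l * t ≤ Real.exp (l * t) := by linarith [Real.add_one_le_exp (l * t)]
  rw [neg_mul, Real.exp_neg, ← div_eq_mul_inv, div_le_iff₀ (Real.exp_pos _), inv_mul_eq_div,
    le_div_iff₀ ht]
  exact hexp

theorem inner_generatorSemigroup (hlam : ∀ k, 0 ≤ lam k) (ht : 0 < t) (x : H) (k : ι) :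
    ⟪b k, generatorSemigroup b lam t x⟫_ℝ = lam k * Real.exp (-lam k * t) * ⟪b k, x⟫_ℝ :=
  inner_multiplier b (fun k => by
    rw [abs_of_nonneg (mul_nonneg (hlam k) (Real.exp_pos _).le)]
    exact mul_exp_neg_mul_le_inv ht) x k

/-- The convolution `∫ τ in a..t, exp (-(t - τ) A) (h τ)` of the semigroup with a source. -/
def duhamel (lam : ι → ℝ) (a : ℝ) (h : ℝ → H) (t : ℝ) : H :=
  ∫ τ in a..t, semigroup b lam (t - τ) (h τ)

theorem continuous_semigroup_sub_source (hlam : ∀ k, 0 ≤ lam k) (hh : Continuous h) :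
    Continuous fun z : ℝ × ℝ => semigroup b lam (z.1 - z.2) (h z.2) :=
  (continuous_semigroup b hlam).comp
    ((continuous_fst.sub continuous_snd).prodMk (hh.comp continuous_snd))

theorem continuous_duhamel (hlam : ∀ k, 0 ≤ lam k) (hh : Continuous h) :
    Continuous (duhamel b lam a h) :=
  intervalIntegral.continuous_parametric_intervalIntegral_of_continuous
    (continuous_semigroup_sub_source b hlam hh) continuous_id

/-- The mild solution of `V' + A V = h`, `V a = φ`. -/
def mildSolution (lam : ι → ℝ) (a : ℝ) (φ : H) (h : ℝ → H) (t : ℝ) : H :=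
  semigroup b lam (t - a) φ + duhamel b lam a h t

theorem continuous_mildSolution (hlam : ∀ k, 0 ≤ lam k) (hh : Continuous h) :
    Continuous (mildSolution b lam a φ h) :=
  ((continuous_semigroup b hlam).comp ((continuous_id.sub continuous_const).prodMk
    continuous_const)).add (continuous_duhamel b hlam hh)

variable [CompleteSpace H]

theorem inner_duhamel (hlam : ∀ k, 0 ≤ lam k) (hh : Continuous h) (hat : a ≤ t) (k : ι) :
    ⟪b k, duhamel b lam a h t⟫_ℝ
      = ∫ τ in a..t, Real.exp (-lam k * (t - τ)) * ⟪b k, h τ⟫_ℝ := by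
  have hcont : Continuous fun τ => semigroup b lam (t - τ) (h τ) :=
    (continuous_semigroup_sub_source b hlam hh).comp (continuous_const.prodMk continuous_id)
  refine ((innerSL ℝ (b k)).intervalIntegral_comp_comm
    (hcont.intervalIntegrable a t)).symm.trans ?_
  refine intervalIntegral.integral_congr fun τ hτ => ?_
  rw [uIcc_of_le hat] at hτ
  exact inner_semigroup b hlam (sub_nonneg.2 hτ.2) _ k

theorem inner_mildSolution (hlam : ∀ k, 0 ≤ lam k) (hh : Continuous h) (hat : a ≤ t) (k : ι) :
    ⟪b k, mildSolution b lam a φ h t⟫_ℝ = Real.exp (-lam k * (t - a)) * ⟪b k, φ⟫_ℝ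
      + ∫ τ in a..t, Real.exp (-lam k * (t - τ)) * ⟪b k, h τ⟫_ℝ := by
  rw [mildSolution, inner_add_right, inner_semigroup b hlam (sub_nonneg.2 hat),
    inner_duhamel b hlam hh hat]

theorem hasDerivAt_inner_mildSolution (hlam : ∀ k, 0 ≤ lam k) (hh : Continuous h) (hat : a < t)
    (k : ι) : HasDerivAt (fun t => ⟪b k, mildSolution b lam a φ h t⟫_ℝ)
      (⟪b k, h t⟫_ℝ - lam k * ⟪b k, mildSolution b lam a φ h t⟫_ℝ) t := by
  have hderiv := hasDerivAt_exp_mul_add_integral (q := fun _ => -lam k) (Q := fun t => -lam k * t)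
    (fun t => by simpa using (hasDerivAt_id t).const_mul (-lam k))
    (continuous_const.inner hh : Continuous fun t => ⟪b k, h t⟫_ℝ) a ⟪b k, φ⟫_ℝ t
  simp only [← mul_sub] at hderiv
  rw [← inner_mildSolution b hlam hh hat.le] at hderiv
  refine (hderiv.congr_of_eventuallyEq ?_).congr_deriv (by ring)
  filter_upwards [Ioi_mem_nhds hat] with τ hτ
  exact inner_mildSolution b hlam hh (le_of_lt hτ) k

/-- The coefficient of `b k` in `h t - A V t`, where `V` is the mild solution. -/
def mildDerivCoeff (lam : ι → ℝ) (a : ℝ) (φ : H) (h : ℝ → H) (t : ℝ) (k : ι) : ℝ :=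
  ⟪b k, h t⟫_ℝ - lam k * ⟪b k, mildSolution b lam a φ h t⟫_ℝ

/-- The vector `h t - A V t`, where `V` is the mild solution; it is the time derivative of `V`. -/
def mildDeriv (lam : ι → ℝ) (a : ℝ) (φ : H) (h : ℝ → H) (t : ℝ) : H :=
  ofCoeff b (mildDerivCoeff b lam a φ h t)

variable {h' : ℝ → H} {c T : ℝ}

theorem mildDerivCoeff_eq (hlam : ∀ k, 0 ≤ lam k) (hh : Continuous h) (hh' : Continuous h')
    (hac : a < c) (hderiv : ∀ τ ∈ Ioo c T, HasDerivAt h (h' τ) τ) (ht : t ∈ Icc c T) (k : ι) :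
    mildDerivCoeff b lam a φ h t k = Real.exp (-lam k * (t - c)) * mildDerivCoeff b lam a φ h c k
      + ∫ τ in c..t, Real.exp (-lam k * (t - τ)) * ⟪b k, h' τ⟫_ℝ := by
  have hV : Continuous fun t => ⟪b k, mildSolution b lam a φ h t⟫_ℝ :=
    continuous_const.inner (continuous_mildSolution b hlam hh)
  have hhk : Continuous fun t => ⟪b k, h t⟫_ℝ := continuous_const.inner hh
  have hh'k : Continuous fun t => ⟪b k, h' t⟫_ℝ := continuous_const.inner hh'
  simp only [mul_sub]
  refine eq_exp_mul_add_integral (q := fun _ => -lam k) (Q := fun t => -lam k * t)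
    (d := fun t => mildDerivCoeff b lam a φ h t k) (by fun_prop)
    (fun t _ => by simpa using (hasDerivAt_id t).const_mul (-lam k)) hh'k.continuousOn
    (hhk.sub (hV.const_mul _)).continuousOn (fun τ hτ => ?_) ht
  have hhτ : HasDerivAt (fun t => ⟪b k, h t⟫_ℝ) ⟪b k, h' τ⟫_ℝ τ := by
    simpa using (hasDerivAt_const τ (b k)).inner ℝ (hderiv τ hτ)
  refine (hhτ.sub ((hasDerivAt_inner_mildSolution b hlam hh (hac.trans hτ.1) k).const_mul
    (lam k))).congr_deriv ?_
  simp only [mildDerivCoeff]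
  ring

theorem inner_mildDeriv (hlam : ∀ k, 0 ≤ lam k) (hh : Continuous h)
    (hh' : ContDiffOn ℝ 1 h (Ioc a T)) (ht : t ∈ Ioc a T) (k : ι) :
    ⟪b k, mildDeriv b lam a φ h t⟫_ℝ = mildDerivCoeff b lam a φ h t k := by
  obtain ⟨c, hac, hct⟩ := exists_between ht.1
  obtain ⟨h', hh'c, hderiv⟩ := exists_continuous_hasDerivAt hh' ⟨hac, hct.le.trans ht.2⟩
  let y : H := semigroup b lam (t - c) (h c)
    - generatorSemigroup b lam (t - c) (mildSolution b lam a φ h c) + duhamel b lam c h' t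
  have hy (k : ι) : ⟪b k, y⟫_ℝ = mildDerivCoeff b lam a φ h t k := by
    rw [mildDerivCoeff_eq b hlam hh hh'c hac hderiv ⟨hct.le, ht.2⟩, inner_add_right,
      inner_sub_right, inner_semigroup b hlam (sub_nonneg.2 hct.le),
      inner_generatorSemigroup b hlam (sub_pos.2 hct), inner_duhamel b hlam hh'c hct.le,
      mildDerivCoeff]
    ring
  rw [mildDeriv, ← funext hy, ofCoeff_inner]

theorem mildDeriv_eq_mildSolution (hlam : ∀ k, 0 ≤ lam k) (hh : Continuous h)
    (hh' : ContDiffOn ℝ 1 h (Ioc a T)) (hh'c : Continuous h') (hac : a < c)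
    (hderiv : ∀ τ ∈ Ioo c T, HasDerivAt h (h' τ) τ) (ht : t ∈ Icc c T) :
    mildDeriv b lam a φ h t = mildSolution b lam c (mildDeriv b lam a φ h c) h' t :=
  ext_inner b fun k => by
    rw [inner_mildDeriv b hlam hh hh' ⟨hac.trans_le ht.1, ht.2⟩,
      mildDerivCoeff_eq b hlam hh hh'c hac hderiv ht, inner_mildSolution b hlam hh'c ht.1,
      inner_mildDeriv b hlam hh hh' ⟨hac, ht.1.trans ht.2⟩]

theorem continuousOn_mildDeriv (hlam : ∀ k, 0 ≤ lam k) (hh : Continuous h)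
    (hh' : ContDiffOn ℝ 1 h (Ioc a T)) : ContinuousOn (mildDeriv b lam a φ h) (Ioc a T) := by
  intro t ht
  obtain ⟨c, hac, hct⟩ := exists_between ht.1
  obtain ⟨h', hh'c, hderiv⟩ := exists_continuous_hasDerivAt hh' ⟨hac, hct.le.trans ht.2⟩
  have hcont : ContinuousOn (mildDeriv b lam a φ h) (Icc c T) :=
    (continuous_mildSolution b hlam hh'c).continuousOn.congr fun τ hτ =>
      mildDeriv_eq_mildSolution b hlam hh hh' hh'c hac hderiv hτ
  refine (hcont t ⟨hct.le, ht.2⟩).mono_of_mem_nhdsWithin ?_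
  filter_upwards [self_mem_nhdsWithin, mem_nhdsWithin_of_mem_nhds (Ioi_mem_nhds hct)] with τ hτ hcτ
  exact ⟨le_of_lt hcτ, hτ.2⟩

theorem hasDerivWithinAt_of_hasDerivAt_inner {V y : ℝ → H} (hV : ContinuousOn V (Ioc a T))
    (hy : ContinuousOn y (Ioc a T))
    (hderiv : ∀ t ∈ Ioo a T, ∀ k, HasDerivAt (fun t => ⟪b k, V t⟫_ℝ) ⟪b k, y t⟫_ℝ t)
    (ht : t ∈ Ioc a T) : HasDerivWithinAt V (y t) (Ioc a T) t := by
  obtain ⟨c, hac, hct⟩ := exists_between ht.1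
  have hsub : Icc c T ⊆ Ioc a T := fun x hx => ⟨hac.trans_le hx.1, hx.2⟩
  obtain ⟨Y, hY, hYy⟩ := exists_continuous_eqOn_Icc (hct.le.trans ht.2) (hy.mono hsub)
  have hrep : ∀ s ∈ Icc c T, V s = V c + ∫ τ in c..s, Y τ := by
    refine fun s hs => ext_inner b fun k => ?_
    have hint : ⟪b k, ∫ τ in c..s, Y τ⟫_ℝ = ⟪b k, V s⟫_ℝ - ⟪b k, V c⟫_ℝ := by
      refine ((innerSL ℝ (b k)).intervalIntegral_comp_comm
        (hY.intervalIntegrable _ _)).symm.trans ?_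
      refine intervalIntegral.integral_eq_sub_of_hasDerivAt_of_le
        (f := fun t => ⟪b k, V t⟫_ℝ) hs.1
        (continuousOn_const.inner (hV.mono ((Icc_subset_Icc_right hs.2).trans hsub)))
        (fun x hx => ?_) ((continuous_const.inner hY).intervalIntegrable _ _)
      rw [innerSL_apply_apply, hYy ⟨hx.1.le, hx.2.le.trans hs.2⟩]
      exact hderiv x ⟨hac.trans hx.1, hx.2.trans_le hs.2⟩ k
    rw [inner_add_right, hint]
    ring
  have hYt : HasDerivAt (fun s => V c + ∫ τ in c..s, Y τ) (y t) t := by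
    rw [← hYy ⟨hct.le, ht.2⟩]
    exact (hY.integral_hasStrictDerivAt c t).hasDerivAt.const_add _
  refine hYt.hasDerivWithinAt.congr_of_eventuallyEq ?_ (hrep t ⟨hct.le, ht.2⟩)
  filter_upwards [self_mem_nhdsWithin, mem_nhdsWithin_of_mem_nhds (Ioi_mem_nhds hct)] with s hs hcs
  exact hrep s ⟨le_of_lt hcs, hs.2⟩

theorem hasDerivWithinAt_mildSolution (hlam : ∀ k, 0 ≤ lam k) (hh : Continuous h)
    (hh' : ContDiffOn ℝ 1 h (Ioc a T)) (ht : t ∈ Ioc a T) :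
    HasDerivWithinAt (mildSolution b lam a φ h) (mildDeriv b lam a φ h t) (Ioc a T) t := by
  refine hasDerivWithinAt_of_hasDerivAt_inner b (continuous_mildSolution b hlam hh).continuousOn
    (continuousOn_mildDeriv b hlam hh hh') (fun τ hτ k => ?_) ht
  rw [inner_mildDeriv b hlam hh hh' (Ioo_subset_Ioc_self hτ)]
  exact hasDerivAt_inner_mildSolution b hlam hh hτ.1 k

theorem mildSolution_self (hlam : ∀ k, 0 ≤ lam k) (hh : Continuous h) :
    mildSolution b lam a φ h a = φ :=
  ext_inner b fun k => by
    rw [inner_mildSolution b hlam hh le_rfl, sub_self, mul_zero, Real.exp_zero, one_mul,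
      intervalIntegral.integral_same, add_zero]

theorem exists_hasDerivWithinAt_inner_eq (hlam : ∀ k, 0 ≤ lam k) (φ : H) {p : ℝ → ℝ} {f : ℝ → H}
    (haT : a ≤ T) (hp : ContinuousOn p (Icc a T)) (hf : ContinuousOn f (Icc a T))
    (hf' : ContDiffOn ℝ 1 f (Ioc a T)) :
    ∃ u u' : ℝ → H, u a = φ ∧ ContinuousOn u (Icc a T) ∧ ContinuousOn u' (Ioc a T) ∧
      ∀ t ∈ Ioc a T, HasDerivWithinAt u (u' t) (Ioc a T) t ∧
        ∀ k, ⟪b k, u' t⟫_ℝ = (p t - lam k) * ⟪b k, u t⟫_ℝ + ⟪b k, f t⟫_ℝ := by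
  obtain ⟨q, hq, hqp⟩ := exists_continuous_eqOn_Icc haT hp
  obtain ⟨F, hF, hFf⟩ := exists_continuous_eqOn_Icc haT hf
  let P : ℝ → ℝ := fun t => ∫ τ in a..t, q τ
  have hP (t : ℝ) : HasDerivAt P (q t) t := (hq.integral_hasStrictDerivAt a t).hasDerivAt
  have hP1 : ContDiff ℝ 1 P :=
    contDiff_one_iff_deriv.2 ⟨fun t => (hP t).differentiableAt, by rwa [deriv_eq hP]⟩
  have hE : Continuous fun t => Real.exp (P t) := hP1.continuous.rexp
  -- The substitution `u = exp (∫ p) • V` turns the equation for `u` into `V' + A V = g`.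
  let g : ℝ → H := fun t => Real.exp (-P t) • F t
  have hg : Continuous g := hP1.continuous.neg.rexp.smul hF
  have hg' : ContDiffOn ℝ 1 g (Ioc a T) :=
    hP1.neg.exp.contDiffOn.smul (hf'.congr fun t ht => hFf (Ioc_subset_Icc_self ht))
  have hV : Continuous (mildSolution b lam a φ g) := continuous_mildSolution b hlam hg
  refine ⟨fun t => Real.exp (P t) • mildSolution b lam a φ g t,
    fun t => Real.exp (P t) • mildDeriv b lam a φ g t
      + (Real.exp (P t) * q t) • mildSolution b lam a φ g t, ?_, (hE.smul hV).continuousOn,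
    (hE.continuousOn.smul (continuousOn_mildDeriv b hlam hg hg')).add
      ((hE.mul hq).smul hV).continuousOn,
    fun t ht => ⟨(hP t).exp.hasDerivWithinAt.smul (hasDerivWithinAt_mildSolution b hlam hg hg' ht),
      fun k => ?_⟩⟩
  · have hPa : P a = 0 := intervalIntegral.integral_same
    simp only [hPa, Real.exp_zero, one_smul, mildSolution_self b hlam hg]
  · have hgf : Real.exp (P t) * ⟪b k, g t⟫_ℝ = ⟪b k, f t⟫_ℝ := by
      rw [← real_inner_smul_right, smul_smul, ← Real.exp_add, add_neg_cancel, Real.exp_zero,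
        one_smul, hFf (Ioc_subset_Icc_self ht)]
    rw [inner_add_right, real_inner_smul_right, real_inner_smul_right, real_inner_smul_right,
      inner_mildDeriv b hlam hg hg' ht, mildDerivCoeff, ← hgf, hqp (Ioc_subset_Icc_self ht)]
    ring

end DiagonalSemigroup

section FormDomain

open scoped InnerProductSpace

theorem inner_submodule_prod {E F : Type*} [NormedAddCommGroup E] [InnerProductSpace ℝ E]
    [NormedAddCommGroup F] [InnerProductSpace ℝ F] {G : Submodule ℝ (WithLp 2 (E × F))} (z w : G) :
    ⟪z, w⟫_ℝ = ⟪z.1.fst, w.1.fst⟫_ℝ + ⟪z.1.snd, w.1.snd⟫_ℝ := by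
  rw [Submodule.coe_inner, WithLp.prod_inner_apply]
  rfl

theorem eq_comp_adjoint_iff {E G : Type*} [NormedAddCommGroup E] [InnerProductSpace ℝ E]
    [CompleteSpace E] [NormedAddCommGroup G] [InnerProductSpace ℝ G] [CompleteSpace G]
    (J : G →L[ℝ] E) {a : E → E → ℝ} (hinner : ∀ z w, ⟪z, w⟫_ℝ = ⟪J z, J w⟫_ℝ + a (J z) (J w))
    (z : G) (x : E) :
    J z = (J ∘L ContinuousLinearMap.adjoint J) x ↔ ∀ w, a (J z) (J w) = ⟪x - J z, J w⟫_ℝ := by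
  refine ⟨fun h w => ?_, fun h => ?_⟩
  · rw [h, inner_sub_left, eq_sub_iff_add_eq', ContinuousLinearMap.comp_apply, ← hinner,
      ContinuousLinearMap.adjoint_inner_left]
  · have hz : z = ContinuousLinearMap.adjoint J x := ext_inner_right ℝ fun w => by
      rw [ContinuousLinearMap.adjoint_inner_left, hinner, h, inner_sub_left, add_sub_cancel]
    exact congrArg J hz

variable {n : ℕ}

/-- The fractional difference quotient `(u x - u y) / |x - y| ^ ((n + 2 s) / 2)`. -/
def diffQuot (s : ℝ) (u : Space n → ℝ) (z : Space n × Space n) : ℝ :=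
  (u z.1 - u z.2) / ‖z.1 - z.2‖ ^ (((n : ℝ) + 2 * s) / 2)

theorem ae_prod_of_ae {p : Space n → Prop} (h : ∀ᵐ x ∂(volume : Measure (Space n)), p x) :
    ∀ᵐ z ∂(volume : Measure (Space n × Space n)), p z.1 ∧ p z.2 :=
  (Measure.quasiMeasurePreserving_fst.ae h).and (Measure.quasiMeasurePreserving_snd.ae h)

theorem diffQuot_add (s : ℝ) (u v : Space n → ℝ) (z : Space n × Space n) :
    diffQuot s (u + v) z = diffQuot s u z + diffQuot s v z := by
  simp only [diffQuot, Pi.add_apply]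
  ring

theorem diffQuot_smul (s c : ℝ) (u : Space n → ℝ) (z : Space n × Space n) :
    diffQuot s (c • u) z = c * diffQuot s u z := by
  simp only [diffQuot, Pi.smul_apply, smul_eq_mul]
  ring

theorem diffQuot_mul_diffQuot (s : ℝ) (u v : Space n → ℝ) (z : Space n × Space n) :
    diffQuot s u z * diffQuot s v z
      = (u z.1 - u z.2) * (v z.1 - v z.2) / ‖z.1 - z.2‖ ^ ((n : ℝ) + 2 * s) := by
  rw [diffQuot, diffQuot, div_mul_div_comm, ← sq, ← Real.rpow_natCast, ← Real.rpow_mul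
    (norm_nonneg _)]
  norm_num

theorem diffQuot_congr (s : ℝ) {u v : Space n → ℝ} (h : u =ᵐ[volume] v) :
    diffQuot s u =ᵐ[volume] diffQuot s v := by
  filter_upwards [ae_prod_of_ae h] with z hz
  rw [diffQuot, diffQuot, hz.1, hz.2]

theorem aestronglyMeasurable_diffQuot (s : ℝ) {u : Space n → ℝ} (hu : AEMeasurable u volume) :
    AEStronglyMeasurable (diffQuot s u) volume := by
  have h1 : AEMeasurable (fun z : Space n × Space n => u z.1) volume :=
    hu.comp_quasiMeasurePreserving Measure.quasiMeasurePreserving_fst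
  have h2 : AEMeasurable (fun z : Space n × Space n => u z.2) volume :=
    hu.comp_quasiMeasurePreserving Measure.quasiMeasurePreserving_snd
  have h3 : Measurable (fun z : Space n × Space n => ‖z.1 - z.2‖ ^ (((n : ℝ) + 2 * s) / 2)) :=
    (measurable_fst.sub measurable_snd).norm.pow_const _
  exact ((h1.sub h2).div h3.aemeasurable).aestronglyMeasurable

theorem innerH0s_eq_integral (s : ℝ) (u v : Space n → ℝ) :
    innerH0s s u v = ∫ z, diffQuot s u z * diffQuot s v z := by
  simp_rw [innerH0s, diffQuot_mul_diffQuot]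

theorem innerH0s_congr (s : ℝ) {u u' v v' : Space n → ℝ} (hu : u =ᵐ[volume] u')
    (hv : v =ᵐ[volume] v') : innerH0s s u v = innerH0s s u' v' := by
  rw [innerH0s_eq_integral, innerH0s_eq_integral]
  refine integral_congr_ae ?_
  filter_upwards [diffQuot_congr s hu, diffQuot_congr s hv] with z h1 h2
  rw [h1, h2]

theorem innerH0s_comm (s : ℝ) (u v : Space n → ℝ) : innerH0s s u v = innerH0s s v u := by
  simp only [innerH0s, mul_comm]

theorem innerH0s_self_nonneg (s : ℝ) (u : Space n → ℝ) : 0 ≤ innerH0s s u u := by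
  rw [innerH0s_eq_integral]
  exact integral_nonneg fun z => mul_self_nonneg _

variable {Ω : Set (Space n)} {s : ℝ}

theorem aemeasurable_zeroExt (hΩ : MeasurableSet Ω) (u : L2 Ω) :
    AEMeasurable (zeroExt Ω u) volume :=
  (aemeasurable_indicator_iff hΩ).2 (Lp.aestronglyMeasurable u).aemeasurable

theorem zeroExt_ae_eq_restrict (hΩ : MeasurableSet Ω) (u : L2 Ω) :
    zeroExt Ω u =ᵐ[volume.restrict Ω] u :=
  indicator_ae_eq_restrict hΩ

theorem zeroExt_ae_eq_of_ae_eq_restrict (hΩ : MeasurableSet Ω) {u : L2 Ω} {v : Space n → ℝ}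
    (h : u =ᵐ[volume.restrict Ω] v) (hv : ∀ᵐ x ∂(volume.restrict Ωᶜ), v x = 0) :
    zeroExt Ω u =ᵐ[volume] v :=
  ((ae_eq_restrict_iff_indicator_ae_eq hΩ).1 h).trans
    (indicator_ae_eq_of_restrict_compl_ae_eq_zero hΩ hv)

theorem zeroExt_zero (hΩ : MeasurableSet Ω) : zeroExt Ω (0 : L2 Ω) =ᵐ[volume] 0 :=
  zeroExt_ae_eq_of_ae_eq_restrict hΩ (Lp.coeFn_zero _ _ _) (by simp)

theorem zeroExt_add (hΩ : MeasurableSet Ω) (u v : L2 Ω) :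
    zeroExt Ω (u + v) =ᵐ[volume] zeroExt Ω u + zeroExt Ω v :=
  ((ae_eq_restrict_iff_indicator_ae_eq hΩ).1 (Lp.coeFn_add u v)).trans
    (.of_eq (indicator_add' Ω u v))

theorem zeroExt_sub (hΩ : MeasurableSet Ω) (u v : L2 Ω) :
    zeroExt Ω (u - v) =ᵐ[volume] zeroExt Ω u - zeroExt Ω v :=
  ((ae_eq_restrict_iff_indicator_ae_eq hΩ).1 (Lp.coeFn_sub u v)).trans
    (.of_eq (indicator_sub' Ω u v))

theorem zeroExt_smul (hΩ : MeasurableSet Ω) (c : ℝ) (u : L2 Ω) :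
    zeroExt Ω (c • u) =ᵐ[volume] c • zeroExt Ω u :=
  ((ae_eq_restrict_iff_indicator_ae_eq hΩ).1 (Lp.coeFn_smul c u)).trans
    (.of_eq (indicator_const_smul Ω c u))

theorem inner_eq_integral (u v : L2 Ω) : ⟪u, v⟫_ℝ = ∫ x in Ω, u x * v x := by
  rw [L2.inner_def]
  exact integral_congr_ae (Eventually.of_forall fun x => mul_comm _ _)

theorem integral_mul_toLp (w : L2 Ω) {v : Space n → ℝ} (hv : MemLp v 2 (volume.restrict Ω)) :
    ∫ x in Ω, w x * v x = ⟪w, hv.toLp v⟫_ℝ := by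
  rw [inner_eq_integral]
  refine integral_congr_ae ?_
  filter_upwards [hv.coeFn_toLp] with x hx
  rw [hx]

theorem MemH0s.memLp_diffQuot (hΩ : MeasurableSet Ω) {u : Space n → ℝ} (hu : MemH0s s Ω u) :
    MemLp (diffQuot s u) 2 volume := by
  have hcross : MeasurableSet (crossSet Ω) := (hΩ.compl.prod hΩ.compl).compl
  refine ((memLp_indicator_iff_restrict hcross).2 hu.memHs.memLp_quotient).ae_eq ?_
  filter_upwards [ae_prod_of_ae ((ae_restrict_iff' hΩ.compl).1 hu.ae_eq_zero)] with z hz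
  by_cases h : z ∈ crossSet Ω
  · rw [indicator_of_mem h, diffQuot]
  · rw [indicator_of_notMem h]
    rw [crossSet, mem_compl_iff, not_not] at h
    rw [diffQuot, hz.1 h.1, hz.2 h.2, sub_zero, zero_div]

theorem memH0s_zeroExt_of_memLp (hΩ : MeasurableSet Ω) (u : L2 Ω)
    (hu : MemLp (diffQuot s (zeroExt Ω u)) 2 volume) : MemH0s s Ω (zeroExt Ω u) where
  memHs := ⟨aemeasurable_zeroExt hΩ u, (Lp.memLp u).ae_eq (zeroExt_ae_eq_restrict hΩ u).symm,
    hu.restrict _⟩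
  ae_eq_zero := by
    filter_upwards [ae_restrict_mem hΩ.compl] with x hx
    rw [zeroExt, indicator_of_notMem hx]

theorem MemH0s.zeroExt_toLp_ae_eq (hΩ : MeasurableSet Ω) {v : Space n → ℝ} (hv : MemH0s s Ω v) :
    zeroExt Ω (hv.memHs.memLp.toLp v) =ᵐ[volume] v :=
  zeroExt_ae_eq_of_ae_eq_restrict hΩ hv.memHs.memLp.coeFn_toLp hv.ae_eq_zero

theorem MemH0s.zeroExt_toLp (hΩ : MeasurableSet Ω) {v : Space n → ℝ} (hv : MemH0s s Ω v) :
    MemH0s s Ω (zeroExt Ω (hv.memHs.memLp.toLp v)) :=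
  memH0s_zeroExt_of_memLp hΩ _
    ((hv.memLp_diffQuot hΩ).ae_eq (diffQuot_congr s (hv.zeroExt_toLp_ae_eq hΩ)).symm)

theorem forall_memH0s_iff_forall_L2 (hΩ : MeasurableSet Ω) {u z : L2 Ω} :
    (∀ v : Space n → ℝ, MemH0s s Ω v → innerH0s s (zeroExt Ω u) v = ∫ x in Ω, z x * v x) ↔
      ∀ v : L2 Ω, MemH0s s Ω (zeroExt Ω v) →
        innerH0s s (zeroExt Ω u) (zeroExt Ω v) = ⟪z, v⟫_ℝ := by
  refine ⟨fun h v hv => ?_, fun h v hv => ?_⟩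
  · rw [h _ hv, inner_eq_integral]
    refine integral_congr_ae ?_
    filter_upwards [zeroExt_ae_eq_restrict hΩ v] with x hx
    rw [hx]
  · rw [integral_mul_toLp z hv.memHs.memLp, ← h _ (hv.zeroExt_toLp hΩ)]
    exact innerH0s_congr s .rfl (hv.zeroExt_toLp_ae_eq hΩ).symm

/-- The form domain `ℍ₀ˢ(Ω)` with the norm `(‖u‖²_{L²(Ω)} + ‖u‖²_{ℍ₀ˢ})^{1/2}`, encoded as the
graph of the map sending `u` to its difference quotient. -/
def formDomain (s : ℝ) (hΩ : MeasurableSet Ω) :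
    Submodule ℝ (WithLp 2 (L2 Ω × Lp ℝ 2 (volume : Measure (Space n × Space n)))) where
  carrier := {z | z.snd =ᵐ[volume] diffQuot s (zeroExt Ω z.fst)}
  add_mem' := by
    intro a b ha hb
    filter_upwards [ha, hb, Lp.coeFn_add a.snd b.snd,
      diffQuot_congr s (zeroExt_add hΩ a.fst b.fst)] with z h1 h2 h3 h4
    rw [WithLp.add_snd, WithLp.add_fst, h3, h4, Pi.add_apply, h1, h2, diffQuot_add]
  zero_mem' := by
    filter_upwards [Lp.coeFn_zero ℝ 2 (volume : Measure (Space n × Space n)),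
      diffQuot_congr s (zeroExt_zero hΩ)] with z h1 h2
    rw [WithLp.zero_snd, WithLp.zero_fst, h1, h2]
    simp [diffQuot]
  smul_mem' := by
    intro c a ha
    filter_upwards [ha, Lp.coeFn_smul c a.snd, diffQuot_congr s (zeroExt_smul hΩ c a.fst)]
      with z h1 h2 h3
    rw [WithLp.smul_snd, WithLp.smul_fst, h2, h3, Pi.smul_apply, h1, diffQuot_smul, smul_eq_mul]

theorem mem_formDomain {hΩ : MeasurableSet Ω}
    {z : WithLp 2 (L2 Ω × Lp ℝ 2 (volume : Measure (Space n × Space n)))} :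
    z ∈ formDomain s hΩ ↔ z.snd =ᵐ[volume] diffQuot s (zeroExt Ω z.fst) := Iff.rfl

theorem tendsto_zeroExt {ι : Type*} {l : Filter ι} {u : ι → L2 Ω} {w : L2 Ω} {x : Space n}
    (h : x ∈ Ω → Tendsto (fun i => u i x) l (𝓝 (w x))) :
    Tendsto (fun i => zeroExt Ω (u i) x) l (𝓝 (zeroExt Ω w x)) := by
  by_cases hx : x ∈ Ω
  · simpa only [zeroExt, indicator_of_mem hx] using h hx
  · simpa only [zeroExt, indicator_of_notMem hx] using tendsto_const_nhds

theorem isClosed_formDomain (hΩ : MeasurableSet Ω) :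
    IsClosed (formDomain s hΩ : Set (WithLp 2 (L2 Ω × Lp ℝ 2 (volume : Measure
      (Space n × Space n))))) := by
  refine IsSeqClosed.isClosed fun z w hz hw => ?_
  have hfst : Tendsto (fun m => (z m).fst) atTop (𝓝 w.fst) :=
    ((WithLp.fstL 2 ℝ _ _).continuous.tendsto w).comp hw
  have hsnd : Tendsto (fun m => (z m).snd) atTop (𝓝 w.snd) :=
    ((WithLp.sndL 2 ℝ _ _).continuous.tendsto w).comp hw
  obtain ⟨ψ, hψ, hψlim⟩ := (tendstoInMeasure_of_tendsto_Lp hfst).exists_seq_tendsto_ae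
  obtain ⟨χ, hχ, hχlim⟩ := (tendstoInMeasure_of_tendsto_Lp
    (hsnd.comp hψ.tendsto_atTop)).exists_seq_tendsto_ae
  rw [SetLike.mem_coe, mem_formDomain]
  filter_upwards [hχlim, ae_prod_of_ae ((ae_restrict_iff' hΩ).1 hψlim),
    ae_all_iff.2 fun m => mem_formDomain.1 (hz m)] with x hlim hψx hzx
  have hquot : Tendsto (fun m => diffQuot s (zeroExt Ω (z (ψ (χ m))).fst) x) atTop
      (𝓝 (diffQuot s (zeroExt Ω w.fst) x)) :=
    (((tendsto_zeroExt hψx.1).comp hχ.tendsto_atTop).sub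
      ((tendsto_zeroExt hψx.2).comp hχ.tendsto_atTop)).div_const _
  exact tendsto_nhds_unique hlim (hquot.congr fun m => (hzx _).symm)

instance completeSpace_formDomain (hΩ : MeasurableSet Ω) : CompleteSpace (formDomain s hΩ) :=
  (isClosed_formDomain hΩ).completeSpace_coe

/-- The embedding of the form domain into `L²(Ω)`. -/
def formEmbedding (s : ℝ) (hΩ : MeasurableSet Ω) : formDomain s hΩ →L[ℝ] L2 Ω :=
  (WithLp.fstL 2 ℝ _ _).comp (formDomain s hΩ).subtypeL

theorem formEmbedding_apply (hΩ : MeasurableSet Ω) (z : formDomain s hΩ) :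
    formEmbedding s hΩ z = z.1.fst := rfl

theorem memH0s_formEmbedding (hΩ : MeasurableSet Ω) (z : formDomain s hΩ) :
    MemH0s s Ω (zeroExt Ω (formEmbedding s hΩ z)) :=
  memH0s_zeroExt_of_memLp hΩ _ ((Lp.memLp z.1.snd).ae_eq (mem_formDomain.1 z.2))

theorem exists_formEmbedding_eq (hΩ : MeasurableSet Ω) {u : L2 Ω}
    (hu : MemH0s s Ω (zeroExt Ω u)) : ∃ z : formDomain s hΩ, formEmbedding s hΩ z = u :=
  ⟨⟨WithLp.toLp 2 (u, (hu.memLp_diffQuot hΩ).toLp _), (hu.memLp_diffQuot hΩ).coeFn_toLp⟩, rfl⟩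

theorem inner_formDomain (hΩ : MeasurableSet Ω) (z w : formDomain s hΩ) :
    ⟪z, w⟫_ℝ = ⟪formEmbedding s hΩ z, formEmbedding s hΩ w⟫_ℝ
      + innerH0s s (zeroExt Ω (formEmbedding s hΩ z)) (zeroExt Ω (formEmbedding s hΩ w)) := by
  refine (inner_submodule_prod (G := formDomain s hΩ) z w).trans ?_
  rw [innerH0s_eq_integral]
  refine congrArg₂ (· + ·) rfl ?_
  rw [L2.inner_def]
  refine integral_congr_ae ?_
  filter_upwards [mem_formDomain.1 z.2, mem_formDomain.1 w.2] with x h1 h2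
  change ⟪z.1.snd x, w.1.snd x⟫_ℝ = _
  rw [h1, h2]
  exact mul_comm _ _

/-- The resolvent `(1 + (-Δ)ˢ)⁻¹` of the Dirichlet fractional Laplacian, as the composition of the
embedding of the form domain with its adjoint. -/
def resolvent (s : ℝ) (hΩ : MeasurableSet Ω) : L2 Ω →L[ℝ] L2 Ω :=
  formEmbedding s hΩ ∘L ContinuousLinearMap.adjoint (formEmbedding s hΩ)

theorem isPositive_resolvent (hΩ : MeasurableSet Ω) : (resolvent s hΩ).IsPositive :=
  ContinuousLinearMap.isPositive_self_comp_adjoint _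

theorem isCompactOperator_resolvent (hΩ : MeasurableSet Ω)
    (hcomp : IsCompactOperator (formEmbedding s hΩ)) : IsCompactOperator (resolvent s hΩ) :=
  hcomp.comp_clm _

theorem memH0s_resolvent (hΩ : MeasurableSet Ω) (x : L2 Ω) :
    MemH0s s Ω (zeroExt Ω (resolvent s hΩ x)) :=
  memH0s_formEmbedding hΩ _

theorem eq_resolvent_iff (hΩ : MeasurableSet Ω) {u x : L2 Ω} (hu : MemH0s s Ω (zeroExt Ω u)) :
    u = resolvent s hΩ x ↔ ∀ v : L2 Ω, MemH0s s Ω (zeroExt Ω v) →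
      innerH0s s (zeroExt Ω u) (zeroExt Ω v) = ⟪x - u, v⟫_ℝ := by
  obtain ⟨z, rfl⟩ := exists_formEmbedding_eq hΩ hu
  refine (eq_comp_adjoint_iff (formEmbedding s hΩ)
    (a := fun u v => innerH0s s (zeroExt Ω u) (zeroExt Ω v)) (inner_formDomain hΩ) z x).trans
    ⟨fun h v hv => ?_, fun h w => h _ (memH0s_formEmbedding hΩ w)⟩
  obtain ⟨w, rfl⟩ := exists_formEmbedding_eq hΩ hv
  exact h w

theorem injective_resolvent (hΩ : MeasurableSet Ω) (hdense : DenseRange (formEmbedding s hΩ)) :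
    Function.Injective (resolvent s hΩ) := by
  refine (injective_iff_map_eq_zero _).2 fun x hx => ?_
  have hadj : ContinuousLinearMap.adjoint (formEmbedding s hΩ) x = 0 := by
    rw [← inner_self_eq_zero (𝕜 := ℝ), ContinuousLinearMap.adjoint_inner_left]
    exact (congrArg (⟪x, ·⟫_ℝ) hx).trans (inner_zero_right x)
  refine hdense.eq_zero_of_inner_left ℝ fun v => ?_
  rw [← ContinuousLinearMap.adjoint_inner_left, hadj, inner_zero_left]

end FormDomain

section Compactness

open scoped ENNReal

theorem isCompactOperator_of_finiteDimensional_approx {E G : Type*} [NormedAddCommGroup E]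
    [InnerProductSpace ℝ E] [CompleteSpace E] [SeminormedAddCommGroup G] [NormedSpace ℝ G]
    (J : G →L[ℝ] E) (h : ∀ ε : ℝ, 0 < ε → ∃ S : Submodule ℝ E, FiniteDimensional ℝ S ∧
      ∀ z, ∃ y ∈ S, ‖J z - y‖ ≤ ε * ‖z‖) : IsCompactOperator J := by
  have hcl := isClosed_setOfPred_isCompactOperator (σ₁₂ := RingHom.id ℝ) (M₁ := G) (M₂ := E)
  change J ∈ {f : G →L[ℝ] E | IsCompactOperator f}
  rw [← hcl.closure_eq, Metric.mem_closure_iff]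
  intro ε hε
  obtain ⟨S, hS, hz⟩ := h (ε / 2) (half_pos hε)
  refine ⟨S.starProjection.comp J, ?_, ?_⟩
  · have : ProperSpace S := FiniteDimensional.proper ℝ S
    have hS : IsCompactOperator (S.subtypeL : S → E) :=
      isCompactOperator_of_locallyCompactSpace_rng S.subtypeL
    exact hS.comp_clm (S.orthogonalProjectionOnto.comp J)
  · rw [dist_eq_norm]
    refine lt_of_le_of_lt (ContinuousLinearMap.opNorm_le_bound _ (half_pos hε).le fun z => ?_)
      (half_lt_self hε)
    obtain ⟨y, hy, hle⟩ := hz z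
    refine le_trans ?_ hle
    change ‖J z - S.starProjection (J z)‖ ≤ _
    rw [Submodule.starProjection_minimal]
    exact ciInf_le ⟨0, by rintro _ ⟨x, rfl⟩; exact norm_nonneg _⟩ (⟨y, hy⟩ : S)

theorem norm_snd_le_of_submodule_prod {E F : Type*} [NormedAddCommGroup E] [InnerProductSpace ℝ E]
    [NormedAddCommGroup F] [InnerProductSpace ℝ F] {G : Submodule ℝ (WithLp 2 (E × F))} (z : G) :
    ‖z.1.snd‖ ≤ ‖z‖ := by
  rw [Submodule.coe_norm]
  refine le_of_sq_le_sq ?_ (norm_nonneg _)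
  rw [WithLp.prod_norm_sq_eq_of_L2 z.1]
  exact le_add_of_nonneg_left (sq_nonneg _)

theorem norm_le_of_enorm_sq_le {E F : Type*} [SeminormedAddCommGroup E] [SeminormedAddCommGroup F]
    {ε : ℝ} (hε : 0 ≤ ε) {w : E} {q : F} (h : ‖w‖ₑ ^ 2 ≤ ENNReal.ofReal (ε ^ 2) * ‖q‖ₑ ^ 2) :
    ‖w‖ ≤ ε * ‖q‖ := by
  rw [ENNReal.ofReal_pow hε, ← mul_pow, ENNReal.pow_le_pow_left_iff two_ne_zero, ← ofReal_norm,
    ← ofReal_norm, ← ENNReal.ofReal_mul hε] at h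
  exact (ENNReal.ofReal_le_ofReal_iff (by positivity)).1 h

section StepFunctions

variable {α ι : Type*} [MeasurableSpace α] {μ : Measure α}

theorem enorm_sq_eq_lintegral (f : Lp ℝ 2 μ) : ‖f‖ₑ ^ 2 = ∫⁻ x, ‖f x‖ₑ ^ 2 ∂μ := by
  rw [Lp.enorm_def, eLpNorm_eq_lintegral_rpow_enorm_toReal two_ne_zero ENNReal.ofNat_ne_top,
    ← ENNReal.rpow_natCast, ← ENNReal.rpow_mul]
  norm_num

variable {F : Finset ι} {Q : ι → Set α} (hQ : ∀ k, MeasurableSet (Q k)) (hμ : ∀ k, μ (Q k) ≠ ∞)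

theorem coeFn_sum_smul_indicatorConstLp (hdisj : Pairwise (Function.onFun Disjoint Q))
    (a : ι → ℝ) : ∀ᵐ x ∂μ, ∀ k ∈ F, x ∈ Q k →
      (∑ j ∈ F, a j • indicatorConstLp 2 (hQ j) (hμ j) (1 : ℝ) : Lp ℝ 2 μ) x = a k := by
  have hterm : ∀ᵐ x ∂μ, ∀ j ∈ F, (a j • indicatorConstLp 2 (hQ j) (hμ j) (1 : ℝ) : Lp ℝ 2 μ) x
      = (Q j).indicator (fun _ => a j) x := by
    refine (ae_ball_iff F.countable_toSet).2 fun j _ => ?_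
    filter_upwards [Lp.coeFn_smul (a j) (indicatorConstLp 2 (hQ j) (hμ j) (1 : ℝ)),
      indicatorConstLp_coeFn (p := 2) (hs := hQ j) (hμs := hμ j) (c := (1 : ℝ))] with x h1 h2
    rw [h1, Pi.smul_apply, h2, smul_eq_mul, ← indicator_const_mul, mul_one]
  filter_upwards [hterm, Lp.coeFn_finsetSum F
    fun j => (a j • indicatorConstLp 2 (hQ j) (hμ j) (1 : ℝ) : Lp ℝ 2 μ)] with x hx hsum k hk hxk
  rw [hsum, Finset.sum_apply, Finset.sum_congr rfl hx, Finset.sum_eq_single_of_mem k hk,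
    indicator_of_mem hxk]
  exact fun j _ hjk => indicator_of_notMem (Set.disjoint_right.1 (hdisj hjk) hxk) _

theorem enorm_sub_sum_smul_indicatorConstLp_sq (hdisj : Pairwise (Function.onFun Disjoint Q))
    (hF : ∀ᵐ x ∂μ, x ∈ ⋃ k ∈ F, Q k) (u : Lp ℝ 2 μ) (a : ι → ℝ) :
    ‖u - ∑ k ∈ F, a k • indicatorConstLp 2 (hQ k) (hμ k) (1 : ℝ)‖ₑ ^ 2
      = ∑ k ∈ F, ∫⁻ x in Q k, ‖u x - a k‖ₑ ^ 2 ∂μ := by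
  have hcover : ∀ g : α → ℝ≥0∞, ∫⁻ x, g x ∂μ = ∑ k ∈ F, ∫⁻ x in Q k, g x ∂μ := fun g => by
    rw [← lintegral_biUnion_finset (fun k _ l _ hkl => hdisj hkl) (fun k _ => hQ k),
      Measure.restrict_eq_self_of_ae_mem hF]
  rw [enorm_sq_eq_lintegral, hcover]
  refine Finset.sum_congr rfl fun k hk => setLIntegral_congr_fun_ae (hQ k) ?_
  filter_upwards [Lp.coeFn_sub u (∑ k ∈ F, a k • indicatorConstLp 2 (hQ k) (hμ k) (1 : ℝ)),
    coeFn_sum_smul_indicatorConstLp hQ hμ hdisj a] with x hsub hsum hx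
  rw [hsub, Pi.sub_apply, hsum k hk hx]

end StepFunctions

variable {n : ℕ}

theorem enorm_sub_sq_le {s d : ℝ} (hs : 0 < s) (u : Space n → ℝ) (z : Space n × Space n)
    (hz : ‖z.1 - z.2‖ ≤ d) :
    ‖u z.1 - u z.2‖ₑ ^ 2 ≤ ENNReal.ofReal (d ^ ((n : ℝ) + 2 * s)) * ‖diffQuot s u z‖ₑ ^ 2 := by
  have hd : 0 ≤ d := (norm_nonneg _).trans hz
  rw [Real.enorm_eq_ofReal_abs, Real.enorm_eq_ofReal_abs, ← ENNReal.ofReal_pow (abs_nonneg _),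
    ← ENNReal.ofReal_pow (abs_nonneg _), ← ENNReal.ofReal_mul (by positivity), sq_abs, sq_abs]
  refine ENNReal.ofReal_le_ofReal ?_
  rw [sq (diffQuot s u z), diffQuot_mul_diffQuot, ← sq]
  by_cases h : z.1 = z.2
  · simp [h]
  · have hpos : 0 < ‖z.1 - z.2‖ := norm_pos_iff.2 (sub_ne_zero.2 h)
    rw [← mul_div_assoc, le_div_iff₀ (by positivity), mul_comm]
    gcongr

theorem exists_setLIntegral_sub_const_le {s d : ℝ} (hs : 0 < s) {u : Space n → ℝ}
    (hu : AEMeasurable u volume) {Q : Set (Space n)} (hQ : MeasurableSet Q) (hQ0 : volume Q ≠ 0)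
    (hQt : volume Q ≠ ∞) (hd : ∀ x ∈ Q, ∀ y ∈ Q, ‖x - y‖ ≤ d) :
    ∃ a : ℝ, ∫⁻ x in Q, ‖u x - a‖ₑ ^ 2 ≤ ENNReal.ofReal (d ^ ((n : ℝ) + 2 * s)) / volume Q *
      ∫⁻ z in Q ×ˢ Q, ‖diffQuot s u z‖ₑ ^ 2 := by
  have h1 : AEMeasurable (fun z : Space n × Space n => u z.1) (volume.prod volume) :=
    hu.comp_quasiMeasurePreserving Measure.quasiMeasurePreserving_fst
  have h2 : AEMeasurable (fun z : Space n × Space n => u z.2) (volume.prod volume) :=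
    hu.comp_quasiMeasurePreserving Measure.quasiMeasurePreserving_snd
  have hm : AEMeasurable (fun z : Space n × Space n => ‖u z.1 - u z.2‖ₑ ^ 2)
      ((volume.restrict Q).prod (volume.restrict Q)) := by
    rw [Measure.prod_restrict]
    exact ((h1.sub h2).enorm.pow_const 2).restrict
  -- Some value `u y` with `y ∈ Q` does at least as well as the average over `y`.
  obtain ⟨y, -, hle⟩ := exists_le_setLAverage (f := fun y => ∫⁻ x in Q, ‖u x - u y‖ₑ ^ 2) hQ0 hQt
    hm.prod_swap.lintegral_prod_right'
  refine ⟨u y, hle.trans ?_⟩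
  rw [setLAverage_eq, ← lintegral_prod_symm _ hm, Measure.prod_restrict,
    ← ENNReal.mul_div_right_comm, ← lintegral_const_mul' _ _ ENNReal.ofReal_ne_top]
  refine ENNReal.div_le_div_right (setLIntegral_mono' (hQ.prod hQ) fun z hz => ?_) _
  exact enorm_sub_sq_le hs u z (hd _ hz.1 _ hz.2)

section Grid

variable {m : ℕ} [NeZero m] {k : Fin n → ℤ}

/-- The half-open cube of side `1 / m` with lower corner `k / m`. -/
def gridCube (m : ℕ) [NeZero m] (k : Fin n → ℤ) : Set (Space n) :=
  WithLp.ofLp ⁻¹' (BoxIntegral.unitPartition.box m k : Set (Fin n → ℝ))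

theorem disjoint_gridCube : Pairwise (Function.onFun Disjoint (gridCube (n := n) m)) :=
  fun _ _ hkl => (BoxIntegral.unitPartition.disjoint.1 hkl).preimage _

theorem measurableSet_gridCube (m : ℕ) [NeZero m] (k : Fin n → ℤ) :
    MeasurableSet (gridCube m k) :=
  (BoxIntegral.Box.measurableSet_coe _).preimage (WithLp.measurable_ofLp 2 _)

theorem volume_gridCube (m : ℕ) [NeZero m] (k : Fin n → ℤ) :
    volume (gridCube m k) = 1 / (m : ℝ≥0∞) ^ n := by
  rw [gridCube, (PiLp.volume_preserving_ofLp (Fin n)).measure_preimage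
    (BoxIntegral.Box.measurableSet_coe _).nullMeasurableSet,
    BoxIntegral.unitPartition.volume_box, Fintype.card_fin]

theorem norm_sub_le_of_mem_gridCube {x y : Space n} (hx : x ∈ gridCube m k)
    (hy : y ∈ gridCube m k) : ‖x - y‖ ≤ √n / m := by
  have hcoord : ∀ i ∈ Finset.univ, ‖(x - y) i‖ ^ 2 ≤ (1 / m : ℝ) ^ 2 := fun i _ => by
    have hxi := BoxIntegral.unitPartition.mem_box_iff.1 hx i
    have hyi := BoxIntegral.unitPartition.mem_box_iff.1 hy i
    rw [add_div] at hxi hyi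
    rw [PiLp.sub_apply, Real.norm_eq_abs, sq_abs]
    exact sq_le_sq' (by linarith) (by linarith)
  rw [EuclideanSpace.norm_eq, Real.sqrt_le_left (by positivity), div_pow,
    Real.sq_sqrt (Nat.cast_nonneg n)]
  refine (Finset.sum_le_sum hcoord).trans_eq ?_
  rw [Finset.sum_const, Finset.card_univ, Fintype.card_fin, nsmul_eq_mul]
  ring

theorem exists_finset_subset_biUnion_gridCube (m : ℕ) [NeZero m] {Ω : Set (Space n)}
    (hΩ : Bornology.IsBounded Ω) : ∃ F : Finset (Fin n → ℤ), Ω ⊆ ⋃ k ∈ F, gridCube m k := by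
  obtain ⟨R, hR⟩ := hΩ.exists_norm_le
  refine ⟨Fintype.piFinset fun _ => Finset.Icc (⌈m * -R⌉ - 1) (⌈m * R⌉ - 1), fun x hx => ?_⟩
  refine mem_iUnion₂.2 ⟨BoxIntegral.unitPartition.index m (WithLp.ofLp x), ?_,
    BoxIntegral.unitPartition.mem_box_iff_index.2 rfl⟩
  refine Fintype.mem_piFinset.2 fun i => Finset.mem_Icc.2 ?_
  have hi := abs_le.1 ((PiLp.norm_apply_le x i).trans (hR x hx))
  have hm : (0 : ℝ) ≤ m := Nat.cast_nonneg m
  exact ⟨sub_le_sub_right (Int.ceil_le_ceil (mul_le_mul_of_nonneg_left hi.1 hm)) 1,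
    sub_le_sub_right (Int.ceil_le_ceil (mul_le_mul_of_nonneg_left hi.2 hm)) 1⟩

end Grid

variable {s : ℝ} {Ω : Set (Space n)}

theorem exists_step_approx (hs : 0 < s) (hΩ : MeasurableSet Ω) {m : ℕ} [NeZero m]
    {F : Finset (Fin n → ℤ)} (hF : Ω ⊆ ⋃ k ∈ F, gridCube m k)
    (hfin : ∀ k, volume.restrict Ω (gridCube m k) ≠ ∞) (u : L2 Ω) :
    ∃ a : (Fin n → ℤ) → ℝ, ‖u - ∑ k ∈ F,
        a k • indicatorConstLp 2 (measurableSet_gridCube m k) (hfin k) (1 : ℝ)‖ₑ ^ 2 ≤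
      ENNReal.ofReal ((√n / m) ^ ((n : ℝ) + 2 * s) * m ^ n) *
        ∫⁻ z, ‖diffQuot s (zeroExt Ω u) z‖ₑ ^ 2 := by
  have hm : (m : ℝ≥0∞) ^ n ≠ 0 := pow_ne_zero _ (Nat.cast_ne_zero.2 (NeZero.ne m))
  have hm' : (m : ℝ≥0∞) ^ n ≠ ∞ := ENNReal.pow_ne_top (ENNReal.natCast_ne_top m)
  have hconst : ∀ k : Fin n → ℤ, ENNReal.ofReal ((√n / m) ^ ((n : ℝ) + 2 * s)) /
      volume (gridCube m k) = ENNReal.ofReal ((√n / m) ^ ((n : ℝ) + 2 * s) * m ^ n) := fun k => by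
    rw [volume_gridCube, one_div, div_eq_mul_inv, inv_inv, ENNReal.ofReal_mul (by positivity),
      ENNReal.ofReal_pow (Nat.cast_nonneg m), ENNReal.ofReal_natCast]
  choose a ha using fun k => exists_setLIntegral_sub_const_le hs (aemeasurable_zeroExt hΩ u)
    (measurableSet_gridCube m k) (by simp [volume_gridCube, hm'])
    (by simp [volume_gridCube, hm, -pow_eq_zero_iff])
    (fun x hx y hy => norm_sub_le_of_mem_gridCube hx hy)
  refine ⟨a, ?_⟩
  rw [enorm_sub_sum_smul_indicatorConstLp_sq _ _ disjoint_gridCube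
    ((ae_restrict_mem hΩ).mono fun x hx => hF hx)]
  set C := ENNReal.ofReal ((√n / m) ^ ((n : ℝ) + 2 * s) * m ^ n)
  calc ∑ k ∈ F, ∫⁻ x in gridCube m k, ‖u x - a k‖ₑ ^ 2 ∂(volume.restrict Ω)
      = ∑ k ∈ F, ∫⁻ x in gridCube m k, ‖zeroExt Ω u x - a k‖ₑ ^ 2 ∂(volume.restrict Ω) := by
        refine Finset.sum_congr rfl fun k _ => lintegral_congr_ae (ae_restrict_of_ae ?_)
        filter_upwards [zeroExt_ae_eq_restrict hΩ u] with x hx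
        rw [hx]
    _ ≤ ∑ k ∈ F, C * ∫⁻ z in gridCube m k ×ˢ gridCube m k, ‖diffQuot s (zeroExt Ω u) z‖ₑ ^ 2 := by
        refine Finset.sum_le_sum fun k _ => le_trans ?_ ((ha k).trans_eq (by rw [hconst]))
        exact lintegral_mono' (Measure.restrict_mono_measure Measure.restrict_le_self _) le_rfl
    _ = C * ∫⁻ z in ⋃ k ∈ F, gridCube m k ×ˢ gridCube m k, ‖diffQuot s (zeroExt Ω u) z‖ₑ ^ 2 := by
        rw [← Finset.mul_sum, lintegral_biUnion_finset
          (fun k _ l _ hkl => (disjoint_gridCube hkl).set_prod_left _ _)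
          fun k _ => (measurableSet_gridCube m k).prod (measurableSet_gridCube m k)]
    _ ≤ C * ∫⁻ z, ‖diffQuot s (zeroExt Ω u) z‖ₑ ^ 2 := by
        gcongr
        exact Measure.restrict_le_self

theorem tendsto_step_approx_const (n : ℕ) (hs : 0 < s) :
    Tendsto (fun m : ℕ => (√n / m) ^ ((n : ℝ) + 2 * s) * m ^ n) atTop (𝓝 0) := by
  have hpow : Tendsto (fun m : ℕ => √n ^ ((n : ℝ) + 2 * s) * (m : ℝ) ^ (-(2 * s))) atTop
      (𝓝 0) := by
    simpa only [mul_zero, Function.comp_def] using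
      ((tendsto_rpow_neg_atTop (by positivity : 0 < 2 * s)).comp
        tendsto_natCast_atTop_atTop).const_mul (√n ^ ((n : ℝ) + 2 * s))
  refine hpow.congr' ((eventually_gt_atTop 0).mono fun m hm => ?_)
  have hm' : 0 < (m : ℝ) := Nat.cast_pos.2 hm
  dsimp only
  rw [Real.div_rpow (by positivity) hm'.le, Real.rpow_add hm', Real.rpow_neg hm'.le,
    Real.rpow_natCast]
  field_simp

theorem exists_finiteDimensional_approx (hs : 0 < s) (hΩ : MeasurableSet Ω)
    (hb : Bornology.IsBounded Ω) {ε : ℝ} (hε : 0 < ε) :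
    ∃ S : Submodule ℝ (L2 Ω), FiniteDimensional ℝ S ∧ ∀ u : L2 Ω, ∃ y ∈ S, ‖u - y‖ₑ ^ 2 ≤
      ENNReal.ofReal (ε ^ 2) * ∫⁻ z, ‖diffQuot s (zeroExt Ω u) z‖ₑ ^ 2 := by
  obtain ⟨m, hmε, hm⟩ := (((tendsto_step_approx_const n hs).eventually
    (gt_mem_nhds (show (0 : ℝ) < ε ^ 2 by positivity))).and (eventually_ne_atTop 0)).exists
  have : NeZero m := ⟨hm⟩
  obtain ⟨F, hF⟩ := exists_finset_subset_biUnion_gridCube m hb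
  have hfin : ∀ k : Fin n → ℤ, volume.restrict Ω (gridCube m k) ≠ ∞ := fun k =>
    ((measure_mono (subset_univ _)).trans_lt
      ((Measure.restrict_apply_univ Ω).trans_lt hb.measure_lt_top)).ne
  refine ⟨Submodule.span ℝ ((fun k => indicatorConstLp 2 (measurableSet_gridCube m k) (hfin k)
    (1 : ℝ)) '' F), FiniteDimensional.span_of_finite ℝ (F.finite_toSet.image _), fun u => ?_⟩
  obtain ⟨a, ha⟩ := exists_step_approx hs hΩ hF hfin u
  exact ⟨_, Submodule.sum_mem _ fun k hk => Submodule.smul_mem _ _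
    (Submodule.subset_span ⟨k, hk, rfl⟩), ha.trans (by gcongr)⟩

theorem isCompactOperator_formEmbedding (hs : 0 < s) (hΩ : MeasurableSet Ω)
    (hb : Bornology.IsBounded Ω) : IsCompactOperator (formEmbedding s hΩ) := by
  refine isCompactOperator_of_finiteDimensional_approx _ fun ε hε => ?_
  obtain ⟨S, hS, happrox⟩ := exists_finiteDimensional_approx hs hΩ hb hε
  refine ⟨S, hS, fun z => ?_⟩
  obtain ⟨y, hy, hle⟩ := happrox (formEmbedding s hΩ z)
  have hsnd : ∫⁻ x, ‖diffQuot s (zeroExt Ω (formEmbedding s hΩ z)) x‖ₑ ^ 2 = ‖z.1.snd‖ₑ ^ 2 := by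
    rw [enorm_sq_eq_lintegral]
    refine lintegral_congr_ae ?_
    filter_upwards [mem_formDomain.1 z.2] with x hx
    rw [hx, formEmbedding_apply]
  rw [hsnd] at hle
  exact ⟨y, hy, (norm_le_of_enorm_sq_le hε.le hle).trans
    (mul_le_mul_of_nonneg_left (norm_snd_le_of_submodule_prod z) hε.le)⟩

end Compactness

section Density

open scoped InnerProductSpace ContDiff

theorem integrableOn_min_mul_rpow {s A B : ℝ} (hs0 : 0 < s) (hs1 : s < 1) (hA : 0 ≤ A)
    (hB : 0 ≤ B) :
    IntegrableOn (fun r : ℝ => min (A * r ^ 2) B * r ^ (-1 - 2 * s)) (Ioi 0) := by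
  have hmeas : Measurable fun r : ℝ => min (A * r ^ 2) B * r ^ (-1 - 2 * s) := by fun_prop
  have hnorm : ∀ r : ℝ, 0 < r → ‖min (A * r ^ 2) B * r ^ (-1 - 2 * s)‖
      = min (A * r ^ 2) B * r ^ (-1 - 2 * s) := fun r hr => Real.norm_of_nonneg (by positivity)
  rw [← Ioc_union_Ioi_eq_Ioi (zero_le_one (α := ℝ))]
  refine IntegrableOn.union ?_ ?_
  · have hnear : IntegrableOn (fun r : ℝ => A * r ^ (1 - 2 * s)) (Ioc 0 1) :=
      ((intervalIntegrable_iff_integrableOn_Ioc_of_le zero_le_one).1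
        (intervalIntegral.intervalIntegrable_rpow' (by linarith))).const_mul A
    refine hnear.mono' hmeas.aestronglyMeasurable ?_
    filter_upwards [ae_restrict_mem measurableSet_Ioc] with r hr
    have hsplit : r ^ (1 - 2 * s) = r ^ 2 * r ^ (-1 - 2 * s) := by
      rw [← Real.rpow_natCast, ← Real.rpow_add hr.1]
      congr 1
      push_cast
      ring
    rw [hnorm r hr.1, hsplit, ← mul_assoc]
    have := hr.1
    gcongr
    exact min_le_left _ _
  · have hfar : IntegrableOn (fun r : ℝ => B * r ^ (-1 - 2 * s)) (Ioi 1) :=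
      (integrableOn_Ioi_rpow_of_lt (by linarith) one_pos).const_mul B
    refine hfar.mono' hmeas.aestronglyMeasurable ?_
    filter_upwards [ae_restrict_mem measurableSet_Ioi] with r hr
    have hr0 : 0 < r := one_pos.trans hr
    rw [hnorm r hr0]
    gcongr
    exact min_le_right _ _

theorem integrable_min_div_norm_rpow {E : Type*} [NormedAddCommGroup E] [NormedSpace ℝ E]
    [FiniteDimensional ℝ E] [Nontrivial E] [MeasurableSpace E] [BorelSpace E] (μ : Measure E)
    [μ.IsAddHaarMeasure] {s A B : ℝ} (hs0 : 0 < s) (hs1 : s < 1) (hA : 0 ≤ A) (hB : 0 ≤ B) :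
    Integrable (fun w : E => min (A * ‖w‖ ^ 2) B / ‖w‖ ^ ((Module.finrank ℝ E : ℝ) + 2 * s)) μ := by
  rw [integrable_fun_norm_addHaar μ
    (f := fun r : ℝ => min (A * r ^ 2) B / r ^ ((Module.finrank ℝ E : ℝ) + 2 * s))]
  refine (integrableOn_min_mul_rpow hs0 hs1 hA hB).congr_fun (fun r hr => ?_) measurableSet_Ioi
  have hpow : r ^ (-1 - 2 * s) =
      r ^ (Module.finrank ℝ E - 1) / r ^ ((Module.finrank ℝ E : ℝ) + 2 * s) := by
    rw [← Real.rpow_natCast, ← Real.rpow_sub hr, Nat.cast_pred Module.finrank_pos]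
    congr 1
    ring
  simp only [hpow, smul_eq_mul]
  ring

variable {n : ℕ}

theorem diffQuot_sq_le {s : ℝ} {g : Space n → ℝ} {L : NNReal} {M : ℝ} (hL : LipschitzWith L g)
    (hM : ∀ x, ‖g x‖ ≤ M) (z : Space n × Space n) :
    diffQuot s g z ^ 2 ≤
      min ((L : ℝ) ^ 2 * ‖z.1 - z.2‖ ^ 2) ((2 * M) ^ 2) / ‖z.1 - z.2‖ ^ ((n : ℝ) + 2 * s) := by
  rw [sq, diffQuot_mul_diffQuot, ← sq]
  refine div_le_div_of_nonneg_right (le_min ?_ ?_) (by positivity)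
  · have hdist := hL.dist_le_mul z.1 z.2
    rw [dist_eq_norm, dist_eq_norm, Real.norm_eq_abs] at hdist
    rw [← mul_pow, ← sq_abs]
    gcongr
  · have h1 := abs_le.1 (hM z.1)
    have h2 := abs_le.1 (hM z.2)
    exact sq_le_sq' (by linarith) (by linarith)

theorem diffQuot_sq_le_indicator_add_indicator_mul {s : ℝ} {g : Space n → ℝ} {K : Set (Space n)}
    (hK : ∀ x ∉ K, g x = 0) {h : Space n → ℝ} (hh : ∀ z, diffQuot s g z ^ 2 ≤ h (z.1 - z.2))
    (z : Space n × Space n) :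
    diffQuot s g z ^ 2 ≤
      (K.indicator (fun _ => 1) z.1 + K.indicator (fun _ => 1) z.2) * h (z.1 - z.2) := by
  have hnonneg : 0 ≤ h (z.1 - z.2) := (sq_nonneg _).trans (hh z)
  have hind : ∀ x, 0 ≤ K.indicator (fun _ => (1 : ℝ)) x :=
    fun x => indicator_nonneg (fun _ _ => zero_le_one) x
  by_cases hz : z.1 ∉ K ∧ z.2 ∉ K
  · rw [diffQuot, hK _ hz.1, hK _ hz.2, sub_zero, zero_div, zero_pow two_ne_zero]
    exact mul_nonneg (add_nonneg (hind _) (hind _)) hnonneg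
  · refine (hh z).trans (le_mul_of_one_le_left hnonneg ?_)
    rw [not_and_or, not_not, not_not] at hz
    rcases hz with hz | hz
    · rw [indicator_of_mem hz]
      exact le_add_of_nonneg_right (hind _)
    · rw [indicator_of_mem hz]
      exact le_add_of_nonneg_left (hind _)

theorem memLp_diffQuot_of_lipschitzWith [NeZero n] {s : ℝ} (hs0 : 0 < s) (hs1 : s < 1)
    {g : Space n → ℝ} {L : NNReal} (hL : LipschitzWith L g) (hgc : HasCompactSupport g) :
    MemLp (diffQuot s g) 2 volume := by
  have hms : AEStronglyMeasurable (diffQuot s g) volume :=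
    aestronglyMeasurable_diffQuot s hL.continuous.measurable.aemeasurable
  rw [memLp_two_iff_integrable_sq hms]
  obtain ⟨M, hM⟩ := hL.continuous.bounded_above_of_compact_support hgc
  set h : Space n → ℝ := fun w =>
    min ((L : ℝ) ^ 2 * ‖w‖ ^ 2) ((2 * M) ^ 2) / ‖w‖ ^ ((n : ℝ) + 2 * s)
  have hint : Integrable h volume := by
    simpa only [finrank_euclideanSpace_fin] using
      integrable_min_div_norm_rpow (E := Space n) volume hs0 hs1 (sq_nonneg (L : ℝ))
        (sq_nonneg (2 * M))
  set ind : Space n → ℝ := (tsupport g).indicator fun _ => 1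
  have hind : Integrable ind volume :=
    (integrable_indicator_iff (isClosed_tsupport g).measurableSet).2
      (integrableOn_const hgc.isCompact.measure_lt_top.ne)
  have hsnd : Integrable (fun z : Space n × Space n => ind z.2 * h (z.1 - z.2)) volume :=
    hind.convolution_integrand (ContinuousLinearMap.mul ℝ ℝ) hint
  have hfst : Integrable (fun z : Space n × Space n => ind z.1 * h (z.1 - z.2)) volume := by
    refine hsnd.swap.congr (Eventually.of_forall fun z => ?_)
    simp only [Function.comp_apply, Prod.fst_swap, Prod.snd_swap, h, norm_sub_rev z.2 z.1]
  refine (hfst.add hsnd).mono' (hms.pow 2) (Eventually.of_forall fun z => ?_)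
  rw [Pi.add_apply, ← add_mul, Real.norm_of_nonneg (sq_nonneg _)]
  exact diffQuot_sq_le_indicator_add_indicator_mul
    (fun x => image_eq_zero_of_notMem_tsupport) (h := h) (diffQuot_sq_le hL hM) z

theorem memH0s_of_contDiff [NeZero n] {s : ℝ} (hs0 : 0 < s) (hs1 : s < 1) {Ω : Set (Space n)}
    (hΩ : MeasurableSet Ω) {g : Space n → ℝ} (hg : ContDiff ℝ ∞ g) (hgc : HasCompactSupport g)
    (hgs : tsupport g ⊆ Ω) : MemH0s s Ω g := by
  obtain ⟨L, hL⟩ := hg.lipschitzWith_of_hasCompactSupport hgc (by simp)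
  exact
    { memHs := ⟨hg.continuous.measurable.aemeasurable, hg.continuous.memLp_of_hasCompactSupport hgc,
        (memLp_diffQuot_of_lipschitzWith hs0 hs1 hL hgc).restrict _⟩
      ae_eq_zero := (ae_restrict_mem hΩ.compl).mono fun y hy =>
        image_eq_zero_of_notMem_tsupport fun h => hy (hgs h) }

theorem denseRange_formEmbedding [NeZero n] {s : ℝ} (hs0 : 0 < s) (hs1 : s < 1)
    {Ω : Set (Space n)} (hΩ : IsOpen Ω) : DenseRange (formEmbedding s hΩ.measurableSet) := by
  have hm := hΩ.measurableSet
  suffices hbot : (LinearMap.range (formEmbedding s hm).toLinearMap)ᗮ = ⊥ by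
    rw [← Submodule.topologicalClosure_eq_top_iff,
      ← Submodule.dense_iff_topologicalClosure_eq_top] at hbot
    exact hbot
  rw [Submodule.eq_bot_iff]
  intro x hx
  have hL : MemLp (zeroExt Ω x) 2 volume := (memLp_indicator_iff_restrict hm).2 (Lp.memLp x)
  have hzero := hΩ.ae_eq_zero_of_integral_contDiff_smul_eq_zero (μ := volume)
    ((hL.locallyIntegrable one_le_two).locallyIntegrableOn Ω) fun g hg hgc hgs => by
      have hgL : MemLp g 2 (volume.restrict Ω) := hg.continuous.memLp_of_hasCompactSupport hgc
      obtain ⟨z, hz⟩ := exists_formEmbedding_eq hm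
        ((memH0s_of_contDiff hs0 hs1 hm hg hgc hgs).zeroExt_toLp hm)
      calc ∫ y, g y • zeroExt Ω x y = ∫ y in Ω, x y * g y := by
            rw [← integral_indicator hm]
            refine integral_congr_ae (Eventually.of_forall fun y => ?_)
            simp only [smul_eq_mul, mul_comm, zeroExt, indicator_mul_right]
        _ = ⟪x, hgL.toLp g⟫_ℝ := integral_mul_toLp x hgL
        _ = 0 := by
            rw [← hz, real_inner_comm]
            exact hx _ ⟨z, rfl⟩
  refine Lp.eq_zero_iff_ae_eq_zero.2 ?_
  rw [Filter.EventuallyEq, ae_restrict_iff' hm]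
  filter_upwards [hzero] with y hy hyΩ
  rw [← indicator_of_mem hyΩ x]
  exact hy hyΩ

theorem linearIndependent_indicatorConstLp {α ι : Type*} [MeasurableSpace α] {μ : Measure α}
    {W : ι → Set α} (hW : ∀ k, MeasurableSet (W k)) (hfin : ∀ k, μ (W k) ≠ ⊤)
    (hpos : ∀ k, μ (W k) ≠ 0) (hdisj : Pairwise (Function.onFun Disjoint W)) :
    LinearIndependent ℝ fun k => (indicatorConstLp 2 (hW k) (hfin k) (1 : ℝ) : Lp ℝ 2 μ) := by
  refine linearIndependent_of_ne_zero_of_inner_eq_zero (𝕜 := ℝ) (fun k h => ?_) fun i j hij => ?_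
  · have hinner := L2.real_inner_indicatorConstLp_one_indicatorConstLp_one (hW k) (hW k)
      (hfin k) (hfin k)
    rw [h, inner_zero_left, inter_self] at hinner
    exact (ENNReal.toReal_pos (hpos k) (hfin k)).ne hinner
  · change ⟪_, _⟫_ℝ = 0
    rw [L2.real_inner_indicatorConstLp_one_indicatorConstLp_one (hW i) (hW j) (hfin i) (hfin j),
      (hdisj hij).inter_eq, measureReal_empty]

theorem not_finiteDimensional_Lp_restrict {X : Type*} [TopologicalSpace X] [T2Space X]
    [MeasurableSpace X] [OpensMeasurableSpace X] {μ : Measure X} [μ.IsOpenPosMeasure] {Ω : Set X}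
    (hΩ : IsOpen Ω) (hinf : Ω.Infinite) (hfin : μ Ω ≠ ⊤) :
    ¬ FiniteDimensional ℝ (Lp ℝ 2 (μ.restrict Ω)) := by
  intro hdim
  have := hinf.to_subtype
  obtain ⟨U, hUinf, hUopen, hUdisj⟩ := exists_seq_infinite_isOpen_pairwise_disjoint Ω
  have hWopen : ∀ k, IsOpen (Subtype.val '' U k) := fun k => hΩ.isOpenMap_subtype_val _ (hUopen k)
  have hlin := linearIndependent_indicatorConstLp (μ := μ.restrict Ω)
    (W := fun k => Subtype.val '' U k) (fun k => (hWopen k).measurableSet)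
    (fun k => ((measure_mono (subset_univ _)).trans_lt
      (by rwa [Measure.restrict_apply_univ, lt_top_iff_ne_top])).ne)
    (fun k => by
      rw [Measure.restrict_apply (hWopen k).measurableSet,
        inter_eq_left.2 (Subtype.coe_image_subset Ω (U k))]
      exact ((hWopen k).measure_pos μ ((hUinf k).nonempty.image _)).ne')
    (fun i j hij => (disjoint_image_iff Subtype.val_injective).2 (hUdisj hij))
  exact not_finite_iff_infinite.2 inferInstance hlin.finite

end Density

section Eigensystem

open scoped InnerProductSpace

variable {n : ℕ} {s : ℝ} {Ω : Set (Space n)} {μ : ℝ} {w : L2 Ω} {lam : ℕ → ℝ}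

theorem isEigenpair_iff_forall_L2 (hΩ : MeasurableSet Ω) :
    IsEigenpair s Ω μ w ↔ w ≠ 0 ∧ MemH0s s Ω (zeroExt Ω w) ∧
      ∀ v : L2 Ω, MemH0s s Ω (zeroExt Ω v) →
        innerH0s s (zeroExt Ω w) (zeroExt Ω v) = ⟪μ • w, v⟫_ℝ := by
  have hsmul (v : Space n → ℝ) : μ * ∫ x in Ω, w x * v x = ∫ x in Ω, (μ • w) x * v x := by
    rw [← integral_const_mul]
    refine integral_congr_ae ?_
    filter_upwards [Lp.coeFn_smul μ w] with x hx
    rw [hx, Pi.smul_apply, smul_eq_mul, mul_assoc]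
  rw [← forall_memH0s_iff_forall_L2 hΩ]
  simp only [← hsmul]
  exact ⟨fun h => ⟨h.ne_zero, h.memH0s, h.weak_eq⟩, fun h => ⟨h.1, h.2.1, h.2.2⟩⟩

theorem IsEigenpair.innerH0s_eq (hΩ : MeasurableSet Ω) (h : IsEigenpair s Ω μ w) {v : L2 Ω}
    (hv : MemH0s s Ω (zeroExt Ω v)) :
    innerH0s s (zeroExt Ω w) (zeroExt Ω v) = μ * ⟪w, v⟫_ℝ := by
  rw [((isEigenpair_iff_forall_L2 hΩ).1 h).2.2 v hv, real_inner_smul_left]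

theorem IsEigenpair.nonneg (hΩ : MeasurableSet Ω) (h : IsEigenpair s Ω μ w) : 0 ≤ μ := by
  have hself := h.innerH0s_eq hΩ h.memH0s
  rw [real_inner_self_eq_norm_sq] at hself
  have hw : 0 < ‖w‖ := norm_pos_iff.2 h.ne_zero
  exact nonneg_of_mul_nonneg_left (hself ▸ innerH0s_self_nonneg s (zeroExt Ω w)) (by positivity)

theorem isEigenpair_iff_resolvent_apply (hΩ : MeasurableSet Ω) (hμ : 1 + μ ≠ 0) :
    IsEigenpair s Ω μ w ↔ w ≠ 0 ∧ resolvent s hΩ w = (1 + μ)⁻¹ • w := by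
  have hres : resolvent s hΩ w = (1 + μ)⁻¹ • w ↔ w = resolvent s hΩ ((1 + μ) • w) := by
    rw [eq_inv_smul_iff₀ hμ, map_smul, eq_comm]
  rw [isEigenpair_iff_forall_L2 hΩ, hres]
  refine and_congr_right fun _ => ⟨fun ⟨hw, heq⟩ => ?_, fun heq => ?_⟩
  · rw [eq_resolvent_iff hΩ hw]
    simpa only [add_smul, one_smul, add_sub_cancel_left] using heq
  · have hw : MemH0s s Ω (zeroExt Ω w) := heq ▸ memH0s_resolvent hΩ _
    rw [eq_resolvent_iff hΩ hw] at heq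
    exact ⟨hw, by simpa only [add_smul, one_smul, add_sub_cancel_left] using heq⟩

theorem IsEigenpair.resolvent_apply (hΩ : MeasurableSet Ω) (h : IsEigenpair s Ω μ w) :
    resolvent s hΩ w = (1 + μ)⁻¹ • w :=
  ((isEigenpair_iff_resolvent_apply hΩ (by linarith [h.nonneg hΩ])).1 h).2

theorem isEigenpair_of_resolvent_apply (hΩ : MeasurableSet Ω) {c : ℝ} (hc : c ≠ 0) (hw : w ≠ 0)
    (h : resolvent s hΩ w = c • w) : IsEigenpair s Ω (c⁻¹ - 1) w := by
  have hc' : 1 + (c⁻¹ - 1) = c⁻¹ := by ring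
  refine (isEigenpair_iff_resolvent_apply hΩ (by rw [hc']; exact inv_ne_zero hc)).2 ⟨hw, ?_⟩
  rwa [hc', inv_inv]

theorem exists_isEigensystem_of_isCompactOperator (hΩ : MeasurableSet Ω)
    (hc : IsCompactOperator (resolvent s hΩ)) (hinj : Function.Injective (resolvent s hΩ))
    (hinf : ¬ FiniteDimensional ℝ (L2 Ω)) :
    ∃ (lam : ℕ → ℝ) (e : ℕ → L2 Ω), IsEigensystem s Ω lam e := by
  have hpos := isPositive_resolvent (s := s) hΩ
  obtain ⟨ν, b, hmono, hν, hb⟩ := exists_hilbertBasis_eigenvectors hc hpos hinj hinf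
  refine ⟨fun k => ν k - 1, b, fun k => ?_, b.orthonormal, fun i j hij =>
    sub_le_sub_right (hmono hij) 1, fun μ w hw => ?_⟩
  · rw [← inv_inv (ν k)]
    exact isEigenpair_of_resolvent_apply hΩ (inv_pos.2 (hν k)).ne' (b.orthonormal.ne_zero k) (hb k)
  · have hμ : (1 + μ)⁻¹ ≠ 0 := inv_ne_zero (by linarith [hw.nonneg hΩ])
    have hfin : {k | (ν k)⁻¹ = (1 + μ)⁻¹}.Finite := by
      refine ((tendsto_eigenvalue_cofinite hc b.orthonormal hb).eventually_ne hμ.symm).subset ?_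
      exact fun k hk => not_not.2 hk
    have hset : {k | (ν k)⁻¹ = (1 + μ)⁻¹} = {k | ν k - 1 = μ} := by
      ext k
      exact inv_inj.trans (by rw [mem_ofPred_eq, sub_eq_iff_eq_add'])
    rw [← hset]
    exact mem_span_of_apply_eq_smul hpos.isSymmetric b hb hfin (hw.resolvent_apply hΩ)

theorem IsEigensystem.exists_hilbertBasis_of_isCompactOperator (hΩ : MeasurableSet Ω)
    (hc : IsCompactOperator (resolvent s hΩ)) (hinj : Function.Injective (resolvent s hΩ))
    {e : ℕ → L2 Ω} (h : IsEigensystem s Ω lam e) :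
    ∃ b : HilbertBasis ℕ ℝ (L2 Ω), ⇑b = e := by
  have hspan : (Submodule.span ℝ (range e))ᗮ = ⊥ :=
    orthogonal_span_eq_bot_of_forall_eigenvector_mem hc (isPositive_resolvent hΩ).isSymmetric hinj
      fun c w hc0 hw0 hw => Submodule.span_mono (image_subset_range _ _)
        (h.exhausts _ w (isEigenpair_of_resolvent_apply hΩ hc0 hw0 hw))
  exact ⟨HilbertBasis.mkOfOrthogonalEqBot h.orthonormal hspan,
    HilbertBasis.coe_mkOfOrthogonalEqBot h.orthonormal hspan⟩

section BoundedDomain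

variable [NeZero n]

theorem exists_isEigensystem (hs : s ∈ Ioo (0 : ℝ) 1) (hΩ : IsOpen Ω)
    (hb : Bornology.IsBounded Ω) (hne : Ω.Nonempty) :
    ∃ (lam : ℕ → ℝ) (e : ℕ → L2 Ω), IsEigensystem s Ω lam e := by
  obtain ⟨x, hx⟩ := hne
  exact exists_isEigensystem_of_isCompactOperator hΩ.measurableSet
    (isCompactOperator_resolvent _ (isCompactOperator_formEmbedding hs.1 _ hb))
    (injective_resolvent _ (denseRange_formEmbedding hs.1 hs.2 hΩ))
    (not_finiteDimensional_Lp_restrict hΩ (infinite_of_mem_nhds x (hΩ.mem_nhds hx))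
      hb.measure_lt_top.ne)

theorem IsEigensystem.exists_hilbertBasis (hs : s ∈ Ioo (0 : ℝ) 1) (hΩ : IsOpen Ω)
    (hb : Bornology.IsBounded Ω) {e : ℕ → L2 Ω} (h : IsEigensystem s Ω lam e) :
    ∃ b : HilbertBasis ℕ ℝ (L2 Ω), ⇑b = e :=
  h.exists_hilbertBasis_of_isCompactOperator hΩ.measurableSet
    (isCompactOperator_resolvent _ (isCompactOperator_formEmbedding hs.1 _ hb))
    (injective_resolvent _ (denseRange_formEmbedding hs.1 hs.2 hΩ))

end BoundedDomain

theorem eq_resolvent_add_of_inner_eq (hΩ : MeasurableSet Ω) {b : HilbertBasis ℕ ℝ (L2 Ω)}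
    (h : ∀ k, IsEigenpair s Ω (lam k) (b k)) {u z : L2 Ω}
    (hz : ∀ k, ⟪b k, z⟫_ℝ = lam k * ⟪b k, u⟫_ℝ) : u = resolvent s hΩ (z + u) := by
  refine ext_inner b fun k => ?_
  have hsymm : ⟪resolvent s hΩ (b k), z + u⟫_ℝ = ⟪b k, resolvent s hΩ (z + u)⟫_ℝ :=
    (isPositive_resolvent hΩ).isSymmetric (b k) (z + u)
  have hne : 1 + lam k ≠ 0 := by linarith [(h k).nonneg hΩ]
  rw [← hsymm, (h k).resolvent_apply hΩ, real_inner_smul_left, inner_add_right, hz,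
    eq_inv_mul_iff_mul_eq₀ hne]
  ring

theorem memH0s_of_inner_eq (hΩ : MeasurableSet Ω) {b : HilbertBasis ℕ ℝ (L2 Ω)}
    (h : ∀ k, IsEigenpair s Ω (lam k) (b k)) {u z : L2 Ω}
    (hz : ∀ k, ⟪b k, z⟫_ℝ = lam k * ⟪b k, u⟫_ℝ) : MemH0s s Ω (zeroExt Ω u) :=
  eq_resolvent_add_of_inner_eq hΩ h hz ▸ memH0s_resolvent hΩ _

theorem innerH0s_eq_of_inner_eq (hΩ : MeasurableSet Ω) {b : HilbertBasis ℕ ℝ (L2 Ω)}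
    (h : ∀ k, IsEigenpair s Ω (lam k) (b k)) {u z : L2 Ω}
    (hz : ∀ k, ⟪b k, z⟫_ℝ = lam k * ⟪b k, u⟫_ℝ) {v : L2 Ω} (hv : MemH0s s Ω (zeroExt Ω v)) :
    innerH0s s (zeroExt Ω u) (zeroExt Ω v) = ⟪z, v⟫_ℝ := by
  have hu := (eq_resolvent_iff hΩ (memH0s_of_inner_eq hΩ h hz)).1
    (eq_resolvent_add_of_inner_eq hΩ h hz) v hv
  rwa [add_sub_cancel_right] at hu

end Eigensystem

section WeakSolution

open scoped InnerProductSpace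

theorem contDiffOn_one_of_hasDerivWithinAt {E : Type*} [NormedAddCommGroup E] [NormedSpace ℝ E]
    {u u' : ℝ → E} {A : Set ℝ} (hA : UniqueDiffOn ℝ A)
    (hu : ∀ t ∈ A, HasDerivWithinAt u (u' t) A t) (hu' : ContinuousOn u' A) :
    ContDiffOn ℝ 1 u A :=
  (contDiffOn_one_iff_derivWithin hA).2 ⟨fun t ht => (hu t ht).differentiableWithinAt,
    hu'.congr fun t ht => (hu t ht).derivWithin (hA t ht)⟩

variable {n : ℕ} {s : ℝ} {Ω : Set (Space n)} {T : ℝ} {p : ℝ → ℝ} {f : ℝ → L2 Ω} {φ : L2 Ω}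
  {u : ℝ → L2 Ω} {lam : ℕ → ℝ}

theorem weak_eq_iff_forall_L2 (hΩ : MeasurableSet Ω) {u u' f : L2 Ω} {ρ : ℝ} :
    (∀ v : Space n → ℝ, MemH0s s Ω v → (∫ x in Ω, u' x * v x) + innerH0s s (zeroExt Ω u) v
        = (∫ x in Ω, ρ * u x * v x) + ∫ x in Ω, f x * v x) ↔
      ∀ v : L2 Ω, MemH0s s Ω (zeroExt Ω v) →
        innerH0s s (zeroExt Ω u) (zeroExt Ω v) = ⟪ρ • u + f - u', v⟫_ℝ := by
  rw [← forall_memH0s_iff_forall_L2 hΩ]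
  refine forall₂_congr fun v hv => ?_
  simp only [mul_assoc, integral_const_mul, integral_mul_toLp _ hv.memHs.memLp, inner_sub_left,
    inner_add_left, real_inner_smul_left]
  exact eq_sub_iff_add_eq'.symm

theorem continuousInH0s_of_inner_eq (hΩ : MeasurableSet Ω) {b : HilbertBasis ℕ ℝ (L2 Ω)}
    (h : ∀ k, IsEigenpair s Ω (lam k) (b k)) {z : ℝ → L2 Ω} (hu : ContinuousOn u (Ioc 0 T))
    (hz : ContinuousOn z (Ioc 0 T))
    (hzu : ∀ t ∈ Ioc 0 T, ∀ k, ⟪b k, z t⟫_ℝ = lam k * ⟪b k, u t⟫_ℝ) :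
    ContinuousInH0s s Ω T u := by
  refine ⟨fun t ht => memH0s_of_inner_eq hΩ h (hzu t ht), fun t ht => ?_⟩
  have hcont : ContinuousWithinAt (fun τ => √⟪z τ - z t, u τ - u t⟫_ℝ) (Ioc 0 T) t :=
    (((hz t ht).sub continuousWithinAt_const).inner
      ((hu t ht).sub continuousWithinAt_const)).sqrt
  have hlim : Tendsto (fun τ => √⟪z τ - z t, u τ - u t⟫_ℝ) (𝓝[Ioc 0 T] t) (𝓝 0) := by
    simpa only [ContinuousWithinAt, sub_self, inner_zero_left, Real.sqrt_zero] using hcont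
  refine hlim.congr' ?_
  filter_upwards [self_mem_nhdsWithin] with τ hτ
  have hsub (k : ℕ) : ⟪b k, z τ - z t⟫_ℝ = lam k * ⟪b k, u τ - u t⟫_ℝ := by
    rw [inner_sub_right, inner_sub_right, hzu τ hτ, hzu t ht, mul_sub]
  rw [normH0s, ← innerH0s_eq_of_inner_eq hΩ h hsub (memH0s_of_inner_eq hΩ h hsub),
    innerH0s_congr s (zeroExt_sub hΩ _ _) (zeroExt_sub hΩ _ _)]

theorem isWeakSolution_of_inner_eq (hΩ : MeasurableSet Ω) {b : HilbertBasis ℕ ℝ (L2 Ω)}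
    (h : ∀ k, IsEigenpair s Ω (lam k) (b k)) (hp : ContinuousOn p (Ioc 0 T))
    (hf : ContinuousOn f (Ioc 0 T)) {u' : ℝ → L2 Ω} (hu : ContinuousOn u (Icc 0 T))
    (hu' : ContinuousOn u' (Ioc 0 T))
    (hderiv : ∀ t ∈ Ioc 0 T, HasDerivWithinAt u (u' t) (Ioc 0 T) t)
    (heq : ∀ t ∈ Ioc 0 T, ∀ k,
      ⟪b k, u' t⟫_ℝ = (p t - lam k) * ⟪b k, u t⟫_ℝ + ⟪b k, f t⟫_ℝ) :
    IsWeakSolution s Ω T p f (u 0) u := by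
  have hu0 : ContinuousOn u (Ioc 0 T) := hu.mono Ioc_subset_Icc_self
  have hz (t : ℝ) (ht : t ∈ Ioc 0 T) (k : ℕ) :
      ⟪b k, p t • u t + f t - u' t⟫_ℝ = lam k * ⟪b k, u t⟫_ℝ := by
    rw [inner_sub_right, inner_add_right, real_inner_smul_right, heq t ht]
    ring
  refine ⟨hu, continuousInH0s_of_inner_eq hΩ h hu0 (((hp.smul hu0).add hf).sub hu') hz,
    contDiffOn_one_of_hasDerivWithinAt (uniqueDiffOn_Ioc 0 T) hderiv hu', fun t ht => ?_, rfl⟩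
  have ht' : t ∈ Ioc 0 T := Ioo_subset_Ioc_self ht
  rw [((hderiv t ht').hasDerivAt (Ioc_mem_nhds ht.1 ht.2)).deriv]
  exact (weak_eq_iff_forall_L2 hΩ).2 fun v hv => innerH0s_eq_of_inner_eq hΩ h (hz t ht') hv

theorem exists_isWeakSolution (hΩ : MeasurableSet Ω) (b : HilbertBasis ℕ ℝ (L2 Ω))
    (h : ∀ k, IsEigenpair s Ω (lam k) (b k)) (hT : 0 ≤ T) (φ : L2 Ω)
    (hp : ContinuousOn p (Icc 0 T)) (hf : ContinuousOn f (Icc 0 T))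
    (hf' : ContDiffOn ℝ 1 f (Ioc 0 T)) : ∃ u, IsWeakSolution s Ω T p f φ u := by
  obtain ⟨u, u', rfl, hu, hu', hderiv⟩ :=
    exists_hasDerivWithinAt_inner_eq b (fun k => (h k).nonneg hΩ) φ hT hp hf hf'
  exact ⟨u, isWeakSolution_of_inner_eq hΩ h (hp.mono Ioc_subset_Icc_self)
    (hf.mono Ioc_subset_Icc_self) hu hu' (fun t ht => (hderiv t ht).1) fun t ht => (hderiv t ht).2⟩

theorem IsWeakSolution.congr {v : ℝ → L2 Ω} (hu : IsWeakSolution s Ω T p f φ u) (hT : 0 ≤ T)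
    (huv : EqOn u v (Icc 0 T)) : IsWeakSolution s Ω T p f φ v where
  continuousOn := hu.continuousOn.congr huv.symm
  continuousInH0s := by
    have huv' : EqOn u v (Ioc 0 T) := huv.mono Ioc_subset_Icc_self
    refine ⟨fun t ht => huv' ht ▸ hu.continuousInH0s.memH0s t ht, fun t ht => ?_⟩
    refine (hu.continuousInH0s.tendsto t ht).congr' ?_
    filter_upwards [self_mem_nhdsWithin] with τ hτ
    rw [huv' hτ, huv' ht]
  contDiffOn := hu.contDiffOn.congr (huv.mono Ioc_subset_Icc_self).symm
  weak_eq := fun t ht => by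
    have hnhds : u =ᶠ[𝓝 t] v := huv.eventuallyEq_of_mem (Icc_mem_nhds ht.1 ht.2)
    rw [← hnhds.deriv_eq, ← hnhds.eq_of_nhds]
    exact hu.weak_eq t ht
  initial := (huv (left_mem_Icc.2 hT)).symm.trans hu.initial

theorem IsWeakSolution.hasDerivAt_inner (hΩ : MeasurableSet Ω) (hu : IsWeakSolution s Ω T p f φ u)
    {μ : ℝ} {w : L2 Ω} (hw : IsEigenpair s Ω μ w) {t : ℝ} (ht : t ∈ Ioo 0 T) :
    HasDerivAt (fun t => ⟪w, u t⟫_ℝ) ((p t - μ) * ⟪w, u t⟫_ℝ + ⟪w, f t⟫_ℝ) t := by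
  have hderiv : HasDerivAt u (deriv u t) t :=
    (((hu.contDiffOn.differentiableOn one_ne_zero) t (Ioo_subset_Ioc_self ht)).differentiableAt
      (Ioc_mem_nhds ht.1 ht.2)).hasDerivAt
  have hinner : HasDerivAt (fun t => ⟪w, u t⟫_ℝ) ⟪w, deriv u t⟫_ℝ t := by
    simpa using (hasDerivAt_const t w).inner ℝ hderiv
  refine hinner.congr_deriv ?_
  have hweak := (weak_eq_iff_forall_L2 hΩ).1 (hu.weak_eq t ht) w hw.memH0s
  rw [innerH0s_comm, hw.innerH0s_eq hΩ (hu.continuousInH0s.memH0s t (Ioo_subset_Ioc_self ht)),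
    real_inner_comm w, inner_sub_right, inner_add_right, real_inner_smul_right] at hweak
  linarith

theorem IsWeakSolution.inner_eq (hΩ : MeasurableSet Ω) (hu : IsWeakSolution s Ω T p f φ u)
    (hp : ContinuousOn p (Icc 0 T)) (hf : ContinuousOn f (Icc 0 T)) {e : ℕ → L2 Ω} {k : ℕ}
    (he : IsEigenpair s Ω (lam k) (e k)) {t : ℝ} (ht : t ∈ Icc 0 T) :
    ⟪e k, u t⟫_ℝ = homCoeff lam e p φ k t + sourceCoeff lam e p f k t := by
  obtain ⟨q, hq, hqp⟩ := exists_continuous_eqOn_Icc (ht.1.trans ht.2) hp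
  let Q : ℝ → ℝ := fun t => -lam k * t + ∫ τ in (0 : ℝ)..t, q τ
  have hQ (t : ℝ) : HasDerivAt Q (q t - lam k) t :=
    (((hasDerivAt_id t).const_mul (-lam k)).add
      (hq.integral_hasStrictDerivAt 0 t).hasDerivAt).congr_deriv (by ring)
  have hQ_sub {τ : ℝ} (hτ : τ ∈ Icc 0 T) :
      Q t - Q τ = -lam k * (t - τ) + ∫ y in τ..t, p y := by
    have hpq : ∫ y in τ..t, p y = ∫ y in τ..t, q y :=
      intervalIntegral.integral_congr fun y hy => (hqp (ordConnected_Icc.uIcc_subset hτ ht hy)).symm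
    rw [hpq, ← intervalIntegral.integral_interval_sub_left (hq.intervalIntegrable 0 t)
      (hq.intervalIntegrable 0 τ)]
    ring
  rw [eq_exp_mul_add_integral (d := fun t => ⟪e k, u t⟫_ℝ) (γ := fun t => ⟪e k, f t⟫_ℝ)
    (continuous_iff_continuousAt.2 fun t => (hQ t).continuousAt).continuousOn (fun t _ => hQ t)
    (continuousOn_const.inner hf) (continuousOn_const.inner hu.continuousOn)
    (fun τ hτ => hqp (Ioo_subset_Icc_self hτ) ▸ hu.hasDerivAt_inner hΩ he hτ) ht]
  congr 1
  · rw [hQ_sub (left_mem_Icc.2 (ht.1.trans ht.2)), sub_zero, hu.initial, homCoeff,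
      real_inner_comm, mul_comm]
  · refine intervalIntegral.integral_congr fun τ hτ => ?_
    rw [uIcc_of_le ht.1] at hτ
    simp only [hQ_sub ⟨hτ.1, hτ.2.trans ht.2⟩, real_inner_comm (f τ), mul_comm]

theorem summable_homCoeff_smul (b : HilbertBasis ℕ ℝ (L2 Ω)) (hlam : ∀ k, 0 ≤ lam k) (p : ℝ → ℝ)
    (φ : L2 Ω) {t : ℝ} (ht : 0 ≤ t) : Summable fun k => homCoeff lam b p φ k t • b k := by
  refine (hasSum_inner_smul b
    (Real.exp (∫ τ in (0 : ℝ)..t, p τ) • semigroup b lam t φ)).summable.congr fun k => ?_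
  rw [real_inner_smul_right, inner_semigroup b hlam ht, homCoeff, Real.exp_add, real_inner_comm]
  ring_nf

theorem IsWeakSolution.summable_sourceCoeff_smul (hΩ : MeasurableSet Ω)
    (hu : IsWeakSolution s Ω T p f φ u) (hp : ContinuousOn p (Icc 0 T))
    (hf : ContinuousOn f (Icc 0 T)) {b : HilbertBasis ℕ ℝ (L2 Ω)}
    (h : ∀ k, IsEigenpair s Ω (lam k) (b k)) {t : ℝ} (ht : t ∈ Icc 0 T) :
    Summable fun k => sourceCoeff lam b p f k t • b k := by
  refine ((hasSum_inner_smul b (u t)).summable.sub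
    (summable_homCoeff_smul b (fun k => (h k).nonneg hΩ) p φ ht.1)).congr fun k => ?_
  rw [hu.inner_eq hΩ hp hf (h k) ht, ← sub_smul, add_sub_cancel_left]

theorem IsWeakSolution.eqOn_seriesSolution (hΩ : MeasurableSet Ω)
    (hu : IsWeakSolution s Ω T p f φ u) (hp : ContinuousOn p (Icc 0 T))
    (hf : ContinuousOn f (Icc 0 T)) {b : HilbertBasis ℕ ℝ (L2 Ω)}
    (h : ∀ k, IsEigenpair s Ω (lam k) (b k)) :
    EqOn u (seriesSolution lam b p f φ) (Icc 0 T) := by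
  intro t ht
  rw [seriesSolution, ← (summable_homCoeff_smul b (fun k => (h k).nonneg hΩ) p φ ht.1).tsum_add
    (hu.summable_sourceCoeff_smul hΩ hp hf h ht), ← (hasSum_inner_smul b (u t)).tsum_eq]
  simp only [hu.inner_eq hΩ hp hf (h _) ht, add_smul]

end WeakSolution

end FracHeat

end

theorem mainTheorem5 (n : ℕ) (hn : 0 < n) (s : ℝ) (hs : s ∈ Set.Ioo (0 : ℝ) 1)
    (Ω : Set (FracHeat.Space n)) (hΩ_open : IsOpen Ω) (hΩ_bdd : Bornology.IsBounded Ω)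
    (hΩ_ne : Ω.Nonempty) (T : ℝ) (hT : 0 < T)
    (φ : FracHeat.L2 Ω) (f : ℝ → FracHeat.L2 Ω) (hf : ContinuousOn f (Icc 0 T))
    (hf' : ContDiffOn ℝ 1 f (Ioc 0 T)) (p : ℝ → ℝ) (hp : ContinuousOn p (Icc 0 T)) :
    (∃ (lam : ℕ → ℝ) (e : ℕ → FracHeat.L2 Ω), FracHeat.IsEigensystem s Ω lam e) ∧
    ∀ (lam : ℕ → ℝ) (e : ℕ → FracHeat.L2 Ω), FracHeat.IsEigensystem s Ω lam e →
      (∀ t ∈ Icc (0 : ℝ) T,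
        Summable (fun k => FracHeat.homCoeff lam e p φ k t • e k) ∧
        Summable (fun k => FracHeat.sourceCoeff lam e p f k t • e k)) ∧
      FracHeat.IsWeakSolution s Ω T p f φ (FracHeat.seriesSolution lam e p f φ) ∧
      ∀ v : ℝ → FracHeat.L2 Ω, FracHeat.IsWeakSolution s Ω T p f φ v →
        EqOn v (FracHeat.seriesSolution lam e p f φ) (Icc 0 T) := by
  have : NeZero n := ⟨hn.ne'⟩
  have hΩ : MeasurableSet Ω := hΩ_open.measurableSet
  refine ⟨FracHeat.exists_isEigensystem hs hΩ_open hΩ_bdd hΩ_ne, fun lam e he => ?_⟩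
  obtain ⟨b, rfl⟩ := he.exists_hilbertBasis hs hΩ_open hΩ_bdd
  have hlam (k : ℕ) : 0 ≤ lam k := (he.eigenpair k).nonneg hΩ
  obtain ⟨u, hu⟩ := FracHeat.exists_isWeakSolution hΩ b he.eigenpair hT.le φ hp hf hf'
  refine ⟨fun t ht => ⟨FracHeat.summable_homCoeff_smul b hlam p φ ht.1,
    hu.summable_sourceCoeff_smul hΩ hp hf he.eigenpair ht⟩,
    hu.congr hT.le (hu.eqOn_seriesSolution hΩ hp hf he.eigenpair),
    fun v hv => hv.eqOn_seriesSolution hΩ hp hf he.eigenpair⟩
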